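/- **Theorem (Soundness and ground-completeness of $E_{DNK}$).** *NetKAT.* Let $F=\{f_1,\dots,f_k\}$ be a finite set of fields, the field $f$ taking values in a finite set $V_f$. A packet $\sigma$ assigns to every field $f$ a value in $V_f$. Predicates are $Pr::=0\mid 1\mid f=n\mid Pr+Pr\mid Pr\cdot Pr\mid\neg Pr$ and NetKAT policies are $N::=Pr\mid f\leftarrow n\mid N+N\mid N\cdot N\mid N^*\mid \mathbf{dup}$, with the usual semantics $[\![p]\!]$ mapping a nonempty packet history $\sigma{::}h$ to a set of histories: $[\![0]\!](h)=\emptyset$, $[\![1]\!](h)=\{h\}$; $f=n$ keeps the history iff $\sigma(f)=n$; $[\![\neg a]\!](h)=\{h\}\setminus[\![a]\!](h)$; $f\leftarrow n$ changes $\sigma$ to $\sigma[f:=n]$; $+$ is union, $\cdot$ is Kleisli composition, $p^*$ is the union of all finite iterates of $p$; $[\![\mathbf{dup}]\!](\sigma{::}h)=\{\sigma{::}\sigma{::}h\}$. $E_{NK}$ is the standard NetKAT axiomatization: the Kleene algebra axioms (idempotent semiring, $1+pp^*\equiv p^*\equiv 1+p^*p$, $q+pr\le r\Rightarrow p^*q\le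 r$, $p+qr\le q\Rightarrow pr^*\le q$, where $p\le q$ means $p+q\equiv q$), for predicates the Boolean axioms $a+bc\equiv(a+b)(a+c)$, $a+1\equiv1$, $a+\neg a\equiv1$, $ab\equiv ba$, $a\cdot\neg a\equiv0$, $aa\equiv a$, and the packet axioms $f\leftarrow n\cdot f'\leftarrow n'\equiv f'\leftarrow n'\cdot f\leftarrow n$ and $f\leftarrow n\cdot f'=n'\equiv f'=n'\cdot f\leftarrow n$ for $f\ne f'$, $\mathbf{dup}\cdot f=n\equiv f=n\cdot\mathbf{dup}$, $f\leftarrow n\cdot f=n\equiv f\leftarrow n$, $f=n\cdot f\leftarrow n\equiv f=n$, $f\leftarrow n\cdot f\leftarrow n'\equiv f\leftarrow n'$, $f=n\cdot f=n'\equiv0$ for $n\ne n'$, $\sum_{i\in V_f}f=i\equiv1$. Provability $E_{NK}\vdash z\equiv y$ is by equational logic. A complete test is $\alpha=(f_1=v_1)\cdots(f_k=v_k)$, a complete assignment is $\pi=(f_1\leftarrow v_1)\cdots(f_k\leftarrow v_k)$. *DyNetKAT.* Let $z$ range over $\mathbf{dup}$-free NetKAT policies, $x$ over channel names, $X$ over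 recursion variables, and let prefixes be $a::=z\mid x?z\mid x!z\mid \mathbf{rcfg}_{x,z}$. DyNetKAT policies are $$p::=\bot\mid a;p\mid p\,||\,p\mid p\oplus p\mid\delta_{\mathcal L}(p)\mid\pi_n(p)\mid p\llfloor p\mid p\,|\,p\mid X,$$ where $n\in\mathbb N$ and $\mathcal L$ is a set of actions of the form $x?z$ or $x!z$ (here $\llfloor$ denotes left-merge and $|$ communication-merge). Each variable $X$ has exactly one defining equation $X\triangleq E_X$. A policy is guarded if every occurrence of a variable in it lies below a prefix $a;\_$ , or becomes so after finitely many unfoldings of variables by their definitions. Assume that all defining policies $E_X$ are guarded (consequently every policy is guarded). Transitions $(p,H,H')\xrightarrow{\gamma}(p',H_1,H_1')$, with $H,H',H_1,H_1'$ lists of packets and $\gamma::=(\sigma,\sigma')\mid x?z\mid x!z\mid \mathbf{rcfg}(x,z)$, are generated by the following rules. Labels are compared syntactically. - $(z;p,\ \sigma{::}H,\ H')\xrightarrow{(\sigma,\sigma')}(p,\ H,\ \sigma'{::}H')$ if $\sigma'{::}\langle\rangle\in[\![z]\!](\sigma{::}\langle\rangle)$. For $c\in\{x?z,\,x!z,\,\mathbf{rcfg}_{x,z}\}$,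 $c;p$ goes to $p$ with label $c$ and unchanged lists. - $X$ has the transitions of $E_X$. $p\oplus q$ has those of $p$ and those of $q$. - If $p\xrightarrow{\gamma}p'$ then $p\,||\,q\xrightarrow{\gamma}p'\,||\,q$, $\;q\,||\,p\xrightarrow{\gamma}q\,||\,p'$, $\;p\llfloor q\xrightarrow{\gamma}p'\,||\,q$, $\;\pi_{n+1}(p)\xrightarrow{\gamma}\pi_n(p')$, and, if $\gamma\notin\mathcal L$, $\;\delta_{\mathcal L}(p)\xrightarrow{\gamma}\delta_{\mathcal L}(p')$, all with the same change of the lists. - If one of $p,q$ does $x?z$ and the other does $x!z$ from the same lists, going to $p'$ and $q'$, then $p\,||\,q$ and $p\,|\,q$ go to $p'\,||\,q'$ with label $\mathbf{rcfg}(x,z)$ and unchanged lists. A symmetric relation $R$ on policies is a bisimulation if, whenever $(p,q)\in R$ and $(p,H_0,H_1)\xrightarrow{\gamma}(p',H_0',H_1')$, there is $q'$ with $(q,H_0,H_1)\xrightarrow{\gamma}(q',H_0',H_1')$ and $(p',q')\in R$; $p\sim q$ means that some bisimulation contains $(p,q)$. *Axioms.* $E_{DNK}\vdash p\equiv q$ denotes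 derivability by equational logic (equivalence and congruence for all operators on DyNetKAT policies, where $x?z;\_$, $x!z;\_$ and $\mathbf{rcfg}_{x,z};\_$ are unary operators indexed by $x$ and $z$), with $z;p\equiv y;p$ whenever $E_{NK}\vdash z\equiv y$, the defining equations $X\equiv E_X$, and the following axioms. - (A0) $0;p\equiv\bot$; (A1) $(z+y);p\equiv z;p\oplus y;p$; (A2–A5) $\oplus$ is commutative, associative and idempotent with unit $\bot$; (A6) $p\,||\,q\equiv q\,||\,p$; (A7) $p\,||\,\bot\equiv p$; (A8) $p\,||\,q\equiv p\llfloor q\oplus q\llfloor p\oplus p\,|\,q$; (A9) $\bot\llfloor p\equiv\bot$; (A10) $(a;p)\llfloor q\equiv a;(p\,||\,q)$; (A11) $(p\oplus q)\llfloor r\equiv(p\llfloor r)\oplus(q\llfloor r)$; (A12) $(x?z;p)\,|\,(x!z;q)\equiv\mathbf{rcfg}_{x,z};(p\,||\,q)$; (A13) $(p\oplus q)\,|\,r\equiv(p\,|\,r)\oplus(q\,|\,r)$; (A14) $p\,|\,q\equiv q\,|\,p$. - (A15) $(z;p)\,|\,q\equiv\bot$; $(\mathbf{rcfg}_{x,z};p)\,|\,q\equiv\bot$;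 $(x?z;p)\,|\,(x'?z';q)\equiv\bot$; $(x!z;p)\,|\,(x'!z';q)\equiv\bot$; and $(x?z;p)\,|\,(x'!z';q)\equiv\bot$ if $x\ne x'$ or $z\ne z'$. - For $at::=\alpha\cdot\pi\mid x?z\mid x!z\mid\mathbf{rcfg}_{x,z}$: $\delta_{\mathcal L}(\bot)\equiv\bot$; $\delta_{\mathcal L}(at;p)\equiv at;\delta_{\mathcal L}(p)$ if $at\notin\mathcal L$; $\delta_{\mathcal L}(at;p)\equiv\bot$ if $at\in\mathcal L$; $\delta_{\mathcal L}(p\oplus q)\equiv\delta_{\mathcal L}(p)\oplus\delta_{\mathcal L}(q)$; $\pi_0(p)\equiv\bot$; $\pi_n(\bot)\equiv\bot$; $\pi_{n+1}(at;p)\equiv at;\pi_n(p)$; $\pi_n(p\oplus q)\equiv\pi_n(p)\oplus\pi_n(q)$. - (AIP) $p\equiv q$ if $\pi_n(p)\equiv\pi_n(q)$ for all $n\in\mathbb N$. **Claim.** For all DyNetKAT policies $p,q$: 1. (Soundness) if $E_{DNK}\vdash p\equiv q$, then $p\sim q$; 2. (Ground-completeness) if $p\sim q$, then $E_{DNK}\vdash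 p\equiv q$. -/

import Mathlib

/-! DyNetKAT over finitely many packet fields `f : Fin k`, field `f` taking values in the finite
type `V f`.  Channel names are the elements of `C`, recursion variables those of `X`. -/

namespace DyNetKAT

universe u v w

/-! ### NetKAT -/

/-- A network packet assigns a value to every field. -/
abbrev Packet {k : ℕ} (V : Fin k → Type u) : Type u := ∀ f, V f

/-- A (nonempty) packet history `σ :: h`, as the pair of its head `σ` and its tail `h`. -/
abbrev History {k : ℕ} (V : Fin k → Type u) : Type u := Packet V × List (Packet V)

/-- Raw NetKAT expressions.  Predicates and policies share the symbols `0, 1, +, ·`; the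
grammar, which allows negation on predicates only, is imposed by `IsPred` and `IsPolicy`. -/
inductive NetKAT {k : ℕ} (V : Fin k → Type u) : Type u
  | zero : NetKAT V
  | one : NetKAT V
  | test (f : Fin k) (n : V f) : NetKAT V
  | neg (a : NetKAT V) : NetKAT V
  | assign (f : Fin k) (n : V f) : NetKAT V
  | add (p q : NetKAT V) : NetKAT V
  | mul (p q : NetKAT V) : NetKAT V
  | star (p : NetKAT V) : NetKAT V
  | dup : NetKAT V

namespace NetKAT

variable {k : ℕ} {V : Fin k → Type u}

/-- `Pr ::= 0 | 1 | f = n | Pr + Pr | Pr · Pr | ¬ Pr`. -/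
def IsPred : NetKAT V → Prop
  | zero => True
  | one => True
  | test _ _ => True
  | neg a => IsPred a
  | assign _ _ => False
  | add a b => IsPred a ∧ IsPred b
  | mul a b => IsPred a ∧ IsPred b
  | star _ => False
  | dup => False

/-- `N ::= Pr | f ← n | N + N | N · N | N* | dup`. -/
def IsPolicy : NetKAT V → Prop
  | zero => True
  | one => True
  | test _ _ => True
  | neg a => IsPred a
  | assign _ _ => True
  | add p q => IsPolicy p ∧ IsPolicy q
  | mul p q => IsPolicy p ∧ IsPolicy q
  | star p => IsPolicy p
  | dup => True

/-- `dup` does not occur in the expression. -/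
def DupFree : NetKAT V → Prop
  | zero => True
  | one => True
  | test _ _ => True
  | neg a => DupFree a
  | assign _ _ => True
  | add p q => DupFree p ∧ DupFree q
  | mul p q => DupFree p ∧ DupFree q
  | star p => DupFree p
  | dup => False

/-- Kleisli composition `(f • g)(x) = ⋃ {g(y) | y ∈ f(x)}`. -/
def kcomp {H : Type u} (f g : H → Set H) (x : H) : Set H := {z | ∃ y ∈ f x, z ∈ g y}

/-- `F⁰(h) = {h}` and `Fⁱ⁺¹ = f • Fⁱ`. -/
def iter {H : Type u} (f : H → Set H) : ℕ → H → Set H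
  | 0 => fun h => {h}
  | i + 1 => kcomp f (iter f i)

/-- The denotational semantics of NetKAT on packet histories. -/
def den : NetKAT V → History V → Set (History V)
  | zero => fun _ => ∅
  | one => fun h => {h}
  | test f n => fun h => {h' | h' = h ∧ h.1 f = n}
  | neg a => fun h => {h} \ den a h
  | assign f n => fun h => {(Function.update h.1 f n, h.2)}
  | add p q => fun h => den p h ∪ den q h
  | mul p q => kcomp (den p) (den q)
  | star p => fun h => ⋃ i : ℕ, iter (den p) i h
  | dup => fun h => {(h.1, h.1 :: h.2)}

/-- The sum `p₁ + (p₂ + ⋯)` of a list; the empty sum is `0`. -/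
def sumList : List (NetKAT V) → NetKAT V
  | [] => zero
  | [p] => p
  | p :: q :: l => add p (sumList (q :: l))

/-- The product `p₁ · (p₂ · ⋯)` of a list; the empty product is `1`. -/
def prodList : List (NetKAT V) → NetKAT V
  | [] => one
  | [p] => p
  | p :: q :: l => mul p (prodList (q :: l))

/-- The complete test `f₁ = σ(f₁) · … · f_k = σ(f_k)`. -/
def completeTest (σ : Packet V) : NetKAT V :=
  prodList ((List.finRange k).map fun f => test f (σ f))

/-- The complete assignment `f₁ ← σ(f₁) · … · f_k ← σ(f_k)`. -/
def completeAssign (σ : Packet V) : NetKAT V :=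
  prodList ((List.finRange k).map fun f => assign f (σ f))

/-- `Σᵢ f = i`, the sum over all values `i` of the field `f`. -/
noncomputable def anyValue [∀ f, Fintype (V f)] (f : Fin k) : NetKAT V :=
  sumList ((Finset.univ : Finset (V f)).toList.map fun n => test f n)

/-- The unconditional axioms of `E_NK` (Kleene algebra, Boolean algebra, packet algebra). -/
inductive Ax [∀ f, Fintype (V f)] : NetKAT V → NetKAT V → Prop
  -- Kleene algebra
  | plus_assoc (p q r) : Ax (add p (add q r)) (add (add p q) r)
  | plus_comm (p q) : Ax (add p q) (add q p)
  | plus_zero (p) : Ax (add p zero) p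
  | plus_idem (p) : Ax (add p p) p
  | seq_assoc (p q r) : Ax (mul p (mul q r)) (mul (mul p q) r)
  | one_seq (p) : Ax (mul one p) p
  | seq_one (p) : Ax (mul p one) p
  | seq_dist_l (p q r) : Ax (mul p (add q r)) (add (mul p q) (mul p r))
  | seq_dist_r (p q r) : Ax (mul (add p q) r) (add (mul p r) (mul q r))
  | zero_seq (p) : Ax (mul zero p) zero
  | seq_zero (p) : Ax (mul p zero) zero
  | unroll_l (p) : Ax (add one (mul p (star p))) (star p)
  | unroll_r (p) : Ax (add one (mul (star p) p)) (star p)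
  -- Boolean algebra, for predicates only
  | plus_dist (a b c) : IsPred a → IsPred b → IsPred c →
      Ax (add a (mul b c)) (mul (add a b) (add a c))
  | plus_one (a) : IsPred a → Ax (add a one) one
  | excl_mid (a) : IsPred a → Ax (add a (neg a)) one
  | pred_seq_comm (a b) : IsPred a → IsPred b → Ax (mul a b) (mul b a)
  | contra (a) : IsPred a → Ax (mul a (neg a)) zero
  | seq_idem (a) : IsPred a → Ax (mul a a) a
  -- Packet algebra
  | mod_mod_comm (f f' : Fin k) (n : V f) (n' : V f') : f ≠ f' →
      Ax (mul (assign f n) (assign f' n')) (mul (assign f' n') (assign f n))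
  | mod_filter_comm (f f' : Fin k) (n : V f) (n' : V f') : f ≠ f' →
      Ax (mul (assign f n) (test f' n')) (mul (test f' n') (assign f n))
  | dup_filter_comm (f : Fin k) (n : V f) : Ax (mul dup (test f n)) (mul (test f n) dup)
  | mod_filter (f : Fin k) (n : V f) : Ax (mul (assign f n) (test f n)) (assign f n)
  | filter_mod (f : Fin k) (n : V f) : Ax (mul (test f n) (assign f n)) (test f n)
  | mod_mod (f : Fin k) (n n' : V f) : Ax (mul (assign f n) (assign f n')) (assign f n')
  | filter_contra (f : Fin k) (n n' : V f) : n ≠ n' → Ax (mul (test f n) (test f n')) zero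
  | match_all (f : Fin k) : Ax (anyValue f) one

/-- `E_NK ⊢ p ≡ q`: provability between NetKAT policies.  Here `p ≤ q` stands for
`p + q ≡ q`. -/
inductive Provable [∀ f, Fintype (V f)] : NetKAT V → NetKAT V → Prop
  | ax {p q} : Ax p q → IsPolicy p → IsPolicy q → Provable p q
  | lfp_l {p q r} : Provable (add (add q (mul p r)) r) r →
      Provable (add (mul (star p) q) r) r
  | lfp_r {p q r} : Provable (add (add p (mul q r)) q) q →
      Provable (add (mul p (star r)) q) q
  | refl {p} : IsPolicy p → Provable p p
  | symm {p q} : Provable p q → Provable q p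
  | trans {p q r} : Provable p q → Provable q r → Provable p r
  | add_congr {p p' q q'} : Provable p p' → Provable q q' → Provable (add p q) (add p' q')
  | mul_congr {p p' q q'} : Provable p p' → Provable q q' → Provable (mul p q) (mul p' q')
  | star_congr {p p'} : Provable p p' → Provable (star p) (star p')
  | neg_congr {a a'} : IsPred a → IsPred a' → Provable a a' → Provable (neg a) (neg a')

end NetKAT

/-- The `dup`-free NetKAT policies. -/
abbrev Pol {k : ℕ} (V : Fin k → Type u) : Type u :=
  {p : NetKAT V // p.IsPolicy ∧ p.DupFree}

namespace Pol

variable {k : ℕ} {V : Fin k → Type u}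

/-- The policy `0`. -/
def zero : Pol V := ⟨NetKAT.zero, trivial, trivial⟩

/-- The policy `z + y`. -/
def add (z y : Pol V) : Pol V :=
  ⟨NetKAT.add z.1 y.1, ⟨z.2.1, y.2.1⟩, ⟨z.2.2, y.2.2⟩⟩

theorem prodList_mem : ∀ (l : List (NetKAT V)),
    (∀ p ∈ l, p.IsPolicy ∧ p.DupFree) →
      (NetKAT.prodList l).IsPolicy ∧ (NetKAT.prodList l).DupFree
  | [], _ => ⟨trivial, trivial⟩
  | [p], h => h p (by simp)
  | p :: q :: l, h => by
      have h1 := h p (by simp)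
      have h2 := prodList_mem (q :: l) fun r hr => h r (List.mem_cons_of_mem _ hr)
      exact ⟨⟨h1.1, h2.1⟩, ⟨h1.2, h2.2⟩⟩

theorem completeTest_mem (σ : Packet V) :
    (NetKAT.completeTest σ).IsPolicy ∧ (NetKAT.completeTest σ).DupFree := by
  refine prodList_mem _ fun p hp => ?_
  obtain ⟨f, -, rfl⟩ := List.mem_map.1 hp
  exact ⟨trivial, trivial⟩

theorem completeAssign_mem (σ : Packet V) :
    (NetKAT.completeAssign σ).IsPolicy ∧ (NetKAT.completeAssign σ).DupFree := by
  refine prodList_mem _ fun p hp => ?_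
  obtain ⟨f, -, rfl⟩ := List.mem_map.1 hp
  exact ⟨trivial, trivial⟩

/-- The policy `α · π`, for the complete test `α` given by the values of `σ` and the complete
assignment `π` given by the values of `τ`. -/
def flow (σ τ : Packet V) : Pol V :=
  ⟨NetKAT.mul (NetKAT.completeTest σ) (NetKAT.completeAssign τ),
    ⟨(completeTest_mem σ).1, (completeAssign_mem τ).1⟩,
    ⟨(completeTest_mem σ).2, (completeAssign_mem τ).2⟩⟩

end Pol

/-! ### Syntax of DyNetKAT -/

/-- Communication actions `x?z` and `x!z`. -/
inductive Comm {k : ℕ} (V : Fin k → Type u) (C : Type v) : Type (max u v)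
  | recv (x : C) (z : Pol V) : Comm V C
  | send (x : C) (z : Pol V) : Comm V C

/-- Prefixes `a ::= z | x?z | x!z | rcfg_{x,z}`. -/
inductive Act {k : ℕ} (V : Fin k → Type u) (C : Type v) : Type (max u v)
  | pol (z : Pol V) : Act V C
  | comm (c : Comm V C) : Act V C
  | rcfg (x : C) (z : Pol V) : Act V C

/-- Transition labels `γ ::= (σ, σ') | x?z | x!z | rcfg(x,z)`. -/
inductive Label {k : ℕ} (V : Fin k → Type u) (C : Type v) : Type (max u v)
  | pkt (σ σ' : Packet V) : Label V C
  | comm (c : Comm V C) : Label V C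
  | rcfg (x : C) (z : Pol V) : Label V C

/-- DyNetKAT policies, including the auxiliary operators used in the axiomatization. -/
inductive Policy {k : ℕ} (V : Fin k → Type u) (C : Type v) (X : Type w) : Type (max u v w)
  /-- `⊥` -/
  | bot : Policy V C X
  /-- `a ; p` -/
  | pre (a : Act V C) (p : Policy V C X) : Policy V C X
  /-- `p || q` -/
  | par (p q : Policy V C X) : Policy V C X
  /-- `p ⊕ q` -/
  | choice (p q : Policy V C X) : Policy V C X
  /-- restriction `δ_L(p)`, where `L` is a set of actions of the form `x?z` or `x!z` -/
  | delta (L : Set (Comm V C)) (p : Policy V C X) : Policy V C X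
  /-- projection `π_n(p)` -/
  | proj (n : ℕ) (p : Policy V C X) : Policy V C X
  /-- left-merge `p ⌊⌊ q` -/
  | lmerge (p q : Policy V C X) : Policy V C X
  /-- communication-merge `p | q` -/
  | cmerge (p q : Policy V C X) : Policy V C X
  /-- recursion variable -/
  | var (x : X) : Policy V C X

section

variable {k : ℕ} {V : Fin k → Type u} {C : Type v} {X : Type w}

/-- `a ∈ L` -/
def Act.InSet (L : Set (Comm V C)) : Act V C → Prop
  | .comm c => c ∈ L
  | _ => False

/-- `γ ∈ L` -/
def Label.InSet (L : Set (Comm V C)) : Label V C → Prop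
  | .comm c => c ∈ L
  | _ => False

/-- The prefixes `at ::= α · π | x?z | x!z | rcfg_{x,z}`. -/
def Act.IsAt : Act V C → Prop
  | .pol z => ∃ σ τ : Packet V, z = Pol.flow σ τ
  | _ => True

open Policy

/-! A recursive specification `E` gives every variable `x` its defining equation `x ≜ E x`. -/

/-- Guardedness.  Every occurrence of a variable has to be below a prefix `a ; _`, or the variable
is itself defined by a guarded policy (so that finitely many unfoldings put all variables below
prefixes). -/
inductive Guarded (E : X → Policy V C X) : Policy V C X → Prop
  | bot : Guarded E bot
  | pre (a p) : Guarded E (pre a p)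
  | par {p q} : Guarded E p → Guarded E q → Guarded E (par p q)
  | choice {p q} : Guarded E p → Guarded E q → Guarded E (choice p q)
  | delta (L) {p} : Guarded E p → Guarded E (delta L p)
  | proj (n) {p} : Guarded E p → Guarded E (proj n p)
  | lmerge {p q} : Guarded E p → Guarded E q → Guarded E (lmerge p q)
  | cmerge {p q} : Guarded E p → Guarded E q → Guarded E (cmerge p q)
  | var {x} : Guarded E (E x) → Guarded E (var x)

/-! ### Operational semantics -/

/-- `Step E p H₀ H₁ γ p' H₀' H₁'` is the transition `(p, H₀, H₁) --γ--> (p', H₀', H₁')`. -/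
inductive Step (E : X → Policy V C X) :
    Policy V C X → List (Packet V) → List (Packet V) → Label V C →
      Policy V C X → List (Packet V) → List (Packet V) → Prop
  | pol {z : Pol V} {p σ σ' H H'} : (σ', []) ∈ z.1.den (σ, []) →
      Step E (pre (.pol z) p) (σ :: H) H' (.pkt σ σ') p H (σ' :: H')
  | comm {c p H H'} : Step E (pre (.comm c) p) H H' (.comm c) p H H'
  | rcfg {x z p H H'} : Step E (pre (.rcfg x z) p) H H' (.rcfg x z) p H H'
  | var {x γ p' H₀ H₁ H₀' H₁'} : Step E (E x) H₀ H₁ γ p' H₀' H₁' →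
      Step E (var x) H₀ H₁ γ p' H₀' H₁'
  | choice_l {p q γ p' H₀ H₁ H₀' H₁'} : Step E p H₀ H₁ γ p' H₀' H₁' →
      Step E (choice p q) H₀ H₁ γ p' H₀' H₁'
  | choice_r {p q γ q' H₀ H₁ H₀' H₁'} : Step E q H₀ H₁ γ q' H₀' H₁' →
      Step E (choice p q) H₀ H₁ γ q' H₀' H₁'
  | par_l {p q γ p' H₀ H₁ H₀' H₁'} : Step E p H₀ H₁ γ p' H₀' H₁' →
      Step E (par p q) H₀ H₁ γ (par p' q) H₀' H₁'
  | par_r {p q γ q' H₀ H₁ H₀' H₁'} : Step E q H₀ H₁ γ q' H₀' H₁' →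
      Step E (par p q) H₀ H₁ γ (par p q') H₀' H₁'
  | par_send_recv {p q p' q' x z H H'} :
      Step E p H H' (.comm (.send x z)) p' H H' → Step E q H H' (.comm (.recv x z)) q' H H' →
      Step E (par p q) H H' (.rcfg x z) (par p' q') H H'
  | par_recv_send {p q p' q' x z H H'} :
      Step E p H H' (.comm (.recv x z)) p' H H' → Step E q H H' (.comm (.send x z)) q' H H' →
      Step E (par p q) H H' (.rcfg x z) (par p' q') H H'
  | delta {L p γ p' H₀ H₁ H₀' H₁'} : Step E p H₀ H₁ γ p' H₀' H₁' → ¬ γ.InSet L →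
      Step E (delta L p) H₀ H₁ γ (delta L p') H₀' H₁'
  | proj {n p γ p' H₀ H₁ H₀' H₁'} : Step E p H₀ H₁ γ p' H₀' H₁' →
      Step E (proj (n + 1) p) H₀ H₁ γ (proj n p') H₀' H₁'
  | lmerge {p q γ p' H₀ H₁ H₀' H₁'} : Step E p H₀ H₁ γ p' H₀' H₁' →
      Step E (lmerge p q) H₀ H₁ γ (par p' q) H₀' H₁'
  | cmerge_recv_send {p q p' q' x z H H'} :
      Step E p H H' (.comm (.recv x z)) p' H H' → Step E q H H' (.comm (.send x z)) q' H H' →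
      Step E (cmerge p q) H H' (.rcfg x z) (par p' q') H H'
  | cmerge_send_recv {p q p' q' x z H H'} :
      Step E p H H' (.comm (.send x z)) p' H H' → Step E q H H' (.comm (.recv x z)) q' H H' →
      Step E (cmerge p q) H H' (.rcfg x z) (par p' q') H H'

/-- Bisimulation relations on DyNetKAT policies. -/
def IsBisimulation (E : X → Policy V C X) (R : Policy V C X → Policy V C X → Prop) : Prop :=
  (∀ p q, R p q → R q p) ∧
    ∀ p q, R p q → ∀ H₀ H₁ γ p' H₀' H₁', Step E p H₀ H₁ γ p' H₀' H₁' →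
      ∃ q', Step E q H₀ H₁ γ q' H₀' H₁' ∧ R p' q'

/-- Bisimilarity `p ∼ q`. -/
def Bisimilar (E : X → Policy V C X) (p q : Policy V C X) : Prop :=
  ∃ R, IsBisimulation E R ∧ R p q

/-! ### The axiom system -/

/-- `E_DNK ⊢ p ≡ q`, for the recursive specification `E`: equational logic with the axioms below,
the NetKAT axioms, the defining equations of the variables, and the infinitary rule AIP.  As in the
transition labels, the policy `z` in `x?z`, `x!z` and `rcfg_{x,z}` is part of the name of the
action. -/
inductive Provable [∀ f, Fintype (V f)] (E : X → Policy V C X) :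
    Policy V C X → Policy V C X → Prop
  -- equational logic
  | refl (p) : Provable E p p
  | symm {p q} : Provable E p q → Provable E q p
  | trans {p q r} : Provable E p q → Provable E q r → Provable E p r
  | pre_congr (a) {p p'} : Provable E p p' → Provable E (pre a p) (pre a p')
  | par_congr {p p' q q'} : Provable E p p' → Provable E q q' →
      Provable E (par p q) (par p' q')
  | choice_congr {p p' q q'} : Provable E p p' → Provable E q q' →
      Provable E (choice p q) (choice p' q')
  | delta_congr (L) {p p'} : Provable E p p' → Provable E (delta L p) (delta L p')
  | proj_congr (n) {p p'} : Provable E p p' → Provable E (proj n p) (proj n p')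
  | lmerge_congr {p p' q q'} : Provable E p p' → Provable E q q' →
      Provable E (lmerge p q) (lmerge p' q')
  | cmerge_congr {p p' q q'} : Provable E p p' → Provable E q q' →
      Provable E (cmerge p q) (cmerge p' q')
  -- equations between NetKAT policies, and defining equations of the variables
  | netkat {z y : Pol V} (p) : NetKAT.Provable z.1 y.1 →
      Provable E (pre (.pol z) p) (pre (.pol y) p)
  | unfold (x) : Provable E (var x) (E x)
  -- A0 to A15
  | a0 (p) : Provable E (pre (.pol Pol.zero) p) bot
  | a1 (z y p) : Provable E (pre (.pol (Pol.add z y)) p)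
      (choice (pre (.pol z) p) (pre (.pol y) p))
  | a2 (p q) : Provable E (choice p q) (choice q p)
  | a3 (p q r) : Provable E (choice (choice p q) r) (choice p (choice q r))
  | a4 (p) : Provable E (choice p p) p
  | a5 (p) : Provable E (choice p bot) p
  | a6 (p q) : Provable E (par p q) (par q p)
  | a7 (p) : Provable E (par p bot) p
  | a8 (p q) : Provable E (par p q) (choice (choice (lmerge p q) (lmerge q p)) (cmerge p q))
  | a9 (p) : Provable E (lmerge bot p) bot
  | a10 (a p q) : Provable E (lmerge (pre a p) q) (pre a (par p q))
  | a11 (p q r) : Provable E (lmerge (choice p q) r) (choice (lmerge p r) (lmerge q r))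
  | a12 (x z p q) : Provable E (cmerge (pre (.comm (.recv x z)) p) (pre (.comm (.send x z)) q))
      (pre (.rcfg x z) (par p q))
  | a13 (p q r) : Provable E (cmerge (choice p q) r) (choice (cmerge p r) (cmerge q r))
  | a14 (p q) : Provable E (cmerge p q) (cmerge q p)
  -- A15, `p | q ≡ ⊥ [owise]`, written out
  | a15_pol (z p q) : Provable E (cmerge (pre (.pol z) p) q) bot
  | a15_recv_recv (x x' z z' p q) :
      Provable E (cmerge (pre (.comm (.recv x z)) p) (pre (.comm (.recv x' z')) q)) bot
  | a15_send_send (x x' z z' p q) :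
      Provable E (cmerge (pre (.comm (.send x z)) p) (pre (.comm (.send x' z')) q)) bot
  | a15_recv_send (x x' z z' p q) : x ≠ x' ∨ z ≠ z' →
      Provable E (cmerge (pre (.comm (.recv x z)) p) (pre (.comm (.send x' z')) q)) bot
  | a15_rcfg (x z p q) : Provable E (cmerge (pre (.rcfg x z) p) q) bot
  -- restriction
  | delta_bot (L) : Provable E (delta L bot) bot
  | delta_pre (L) {a} (p) : a.IsAt → ¬ a.InSet L →
      Provable E (delta L (pre a p)) (pre a (delta L p))
  | delta_pre_bot (L) {a} (p) : a.IsAt → a.InSet L → Provable E (delta L (pre a p)) bot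
  | delta_choice (L p q) : Provable E (delta L (choice p q)) (choice (delta L p) (delta L q))
  -- projection
  | proj_zero (p) : Provable E (proj 0 p) bot
  | proj_bot (n) : Provable E (proj n bot) bot
  | proj_pre (n) {a} (p) : a.IsAt → Provable E (proj (n + 1) (pre a p)) (pre a (proj n p))
  | proj_choice (n p q) : Provable E (proj n (choice p q)) (choice (proj n p) (proj n q))
  -- Approximation Induction Principle
  | aip {p q} : (∀ n, Provable E (proj n p) (proj n q)) → Provable E p q

end

end DyNetKAT

/-! Soundness. Provably equal NetKAT policies have equal denotations (`NetKAT.Provable.den_eq`),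
bisimilarity is a congruence, and most of the remaining axioms relate policies with literally the
same transitions. The exception with real content is AIP. Guardedness makes the transition system
image-finite: for fixed lists and a fixed label a policy has finitely many successors
(`Guarded.finite_step`). If every depth `n` has a successor matching up to depth `n`, then one of
these finitely many successors works for all depths, because agreement at a depth implies agreement
at every smaller one (`Bisimilar.of_forall_proj`).

Completeness. Policies modulo `E_NK` form a Kleene algebra. In it the sums of flows `α · π` indexed
by a relation on packets contain all predicates and assignments and are closed under sum, product
and star, which become union, relational composition and reflexive-transitive closure. Hence every
`dup`-free policy is provably a finite sum of flows (`Pol.exists_provable_flows`). Consequently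
every guarded policy is provably a finite sum of terms `at;p` (`Guarded.hasHeadNormalForm`), only
the head being normalized.

Each prefix `at` has a transition that no other such prefix can perform (`Act.IsAt.exists_step`). So
in two bisimilar head normal forms every summand on one side has a partner with the same prefix and
a bisimilar continuation on the other. Induction on `n` then proves the `n`-th projections of
bisimilar policies equal (`Bisimilar.provable_proj`), and AIP concludes. -/

namespace DyNetKAT

universe u v w

/-! ### Soundness of the NetKAT axioms -/

namespace NetKAT

variable {k : ℕ} {V : Fin k → Type u}

theorem mem_kcomp {H : Type u} {f g : H → Set H} {x z : H} :
    z ∈ kcomp f g x ↔ ∃ y ∈ f x, z ∈ g y := Iff.rfl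

/-- Predicates only filter, so composing them amounts to conjunction of conditions on one history.
The soundness of the Boolean axioms rests on this. -/
theorem den_subset_of_isPred {a : NetKAT V} (ha : a.IsPred) (h : History V) :
    a.den h ⊆ {h} := by
  induction a generalizing h with
  | zero => exact Set.empty_subset _
  | one => exact subset_rfl
  | test f n => exact fun x hx => hx.1
  | neg a => exact Set.sdiff_subset
  | assign | star | dup => exact ha.elim
  | add a b iha ihb => exact Set.union_subset (iha ha.1 h) (ihb ha.2 h)
  | mul a b iha ihb =>
    rintro x ⟨y, hy, hx⟩
    obtain rfl := iha ha.1 h hy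
    exact ihb ha.2 _ hx

theorem mem_den_mul_of_isPred {a : NetKAT V} (ha : a.IsPred) (p : NetKAT V) (h h' : History V) :
    h' ∈ (mul a p).den h ↔ h ∈ a.den h ∧ h' ∈ p.den h := by
  constructor
  · rintro ⟨y, hy, hx⟩
    obtain rfl := den_subset_of_isPred ha h hy
    exact ⟨hy, hx⟩
  · exact fun hh => ⟨h, hh.1, hh.2⟩

theorem mem_den_of_isPred {a : NetKAT V} (ha : a.IsPred) (h h' : History V) :
    h' ∈ a.den h ↔ h' = h ∧ h ∈ a.den h := by
  constructor
  · intro hy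
    obtain rfl := den_subset_of_isPred ha h hy
    exact ⟨rfl, hy⟩
  · rintro ⟨rfl, hh⟩; exact hh

theorem mem_den_sumList {l : List (NetKAT V)} {h h' : History V} :
    h' ∈ (sumList l).den h ↔ ∃ p ∈ l, h' ∈ p.den h := by
  match l with
  | [] => simp [sumList, den]
  | [p] => simp [sumList]
  | p :: q :: l =>
    have := mem_den_sumList (l := q :: l) (h := h) (h' := h')
    simp only [sumList, den, Set.mem_union, this, List.mem_cons]
    simp

theorem iter_succ_right {H : Type u} (f : H → Set H) (i : ℕ) :
    iter f (i + 1) = kcomp (iter f i) f := by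
  induction i with
  | zero => ext x z; simp [iter, kcomp]
  | succ i ih =>
    calc iter f (i + 1 + 1) = kcomp f (kcomp (iter f i) f) := by rw [iter, ih]
      _ = kcomp (kcomp f (iter f i)) f := by
        ext x z
        simp only [mem_kcomp]
        grind
      _ = _ := rfl

theorem mem_den_star {p : NetKAT V} {h h' : History V} :
    h' ∈ (star p).den h ↔ ∃ i, h' ∈ iter p.den i h := by
  simp [den]

theorem Ax.den_eq [∀ f, Fintype (V f)] {p q : NetKAT V} (hpq : Ax p q) : p.den = q.den := by
  funext h
  ext h'
  cases hpq with
  | plus_assoc p q r => simp only [den, Set.union_assoc]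
  | plus_comm p q => simp only [den, Set.union_comm]
  | plus_zero p => simp [den]
  | plus_idem p => simp [den]
  | seq_assoc p q r => simp only [den, mem_kcomp]; grind
  | one_seq p => simp [den, mem_kcomp]
  | seq_one p => simp [den, mem_kcomp]
  | seq_dist_l p q r => simp only [den, mem_kcomp, Set.mem_union]; grind
  | seq_dist_r p q r => simp only [den, mem_kcomp, Set.mem_union]; grind
  | zero_seq p => simp [den, mem_kcomp]
  | seq_zero p => simp [den, mem_kcomp]
  | unroll_l p =>
    rw [mem_den_star]
    constructor
    · rintro (hh | ⟨y, hy, hh⟩)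
      · exact ⟨0, hh⟩
      · obtain ⟨i, hi⟩ := mem_den_star.1 hh
        exact ⟨i + 1, y, hy, hi⟩
    · rintro ⟨_ | i, hi⟩
      · exact Or.inl hi
      · obtain ⟨y, hy, hh⟩ := hi
        exact Or.inr ⟨y, hy, mem_den_star.2 ⟨i, hh⟩⟩
  | unroll_r p =>
    rw [mem_den_star]
    constructor
    · rintro (hh | ⟨y, hy, hh⟩)
      · exact ⟨0, hh⟩
      · obtain ⟨i, hi⟩ := mem_den_star.1 hy
        exact ⟨i + 1, by rw [iter_succ_right]; exact ⟨y, hi, hh⟩⟩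
    · rintro ⟨_ | i, hi⟩
      · exact Or.inl hi
      · rw [iter_succ_right] at hi
        obtain ⟨y, hy, hh⟩ := hi
        exact Or.inr ⟨y, mem_den_star.2 ⟨i, hy⟩, hh⟩
  | plus_dist a b c ha hb hc =>
    rw [mem_den_mul_of_isPred (a := add a b) ⟨ha, hb⟩]
    simp only [den, Set.mem_union]
    rw [← den, mem_den_mul_of_isPred hb, mem_den_of_isPred ha h h', mem_den_of_isPred hc h h']
    tauto
  | plus_one a ha =>
    simp only [den, Set.mem_union]
    exact or_iff_right_of_imp fun hh => den_subset_of_isPred ha h hh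
  | excl_mid a ha =>
    simp only [den, Set.mem_union, Set.mem_sdiff]
    have := @den_subset_of_isPred _ _ _ ha h h'
    simp only [Set.mem_singleton_iff] at *
    tauto
  | pred_seq_comm a b ha hb =>
    rw [mem_den_mul_of_isPred ha, mem_den_mul_of_isPred hb, mem_den_of_isPred hb h h',
      mem_den_of_isPred ha h h']
    tauto
  | contra a ha =>
    rw [mem_den_mul_of_isPred ha]
    simp only [den, Set.mem_sdiff, Set.mem_singleton_iff, Set.mem_empty_iff_false, iff_false]
    rintro ⟨h1, rfl, h2⟩
    exact h2 h1
  | seq_idem a ha =>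
    rw [mem_den_mul_of_isPred ha, mem_den_of_isPred ha h h']
    tauto
  | mod_mod_comm f f' n n' hf => simp [den, mem_kcomp, Function.update_comm hf]
  | mod_filter_comm f f' n n' hf =>
    simp only [den, mem_kcomp, Set.mem_singleton_iff, Set.mem_ofPred_eq, exists_eq_left,
      Function.update_of_ne hf.symm]
    grind
  | dup_filter_comm f n =>
    simp only [den, mem_kcomp, Set.mem_singleton_iff, Set.mem_ofPred_eq, exists_eq_left]
    grind
  | mod_filter f n =>
    simp only [den, mem_kcomp, Set.mem_singleton_iff, Set.mem_ofPred_eq, exists_eq_left,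
      Function.update_self, and_true]
  | filter_mod f n =>
    simp only [den, mem_kcomp, Set.mem_singleton_iff, Set.mem_ofPred_eq]
    constructor
    · rintro ⟨y, ⟨rfl, rfl⟩, rfl⟩; simp
    · rintro ⟨rfl, rfl⟩; exact ⟨h', ⟨rfl, rfl⟩, by simp⟩
  | mod_mod f n n' => simp [den, mem_kcomp]
  | filter_contra f n n' hn =>
    simp only [den, mem_kcomp, Set.mem_ofPred_eq, Set.mem_empty_iff_false, iff_false]
    rintro ⟨y, ⟨rfl, rfl⟩, rfl, rfl⟩
    exact hn rfl
  | match_all f => simp [anyValue, mem_den_sumList, den]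

/-- The order `≤` is pointwise inclusion of denotations. The two star rules then follow by induction
on the number of iterations, peeling an iterate off the left for `lfp_l` and off the right for
`lfp_r`. -/
theorem Provable.den_eq [∀ f, Fintype (V f)] {p q : NetKAT V} (hpq : Provable p q) :
    p.den = q.den := by
  have le_iff (p q : NetKAT V) : (add p q).den = q.den ↔ ∀ h, p.den h ⊆ q.den h := by
    simp only [funext_iff, den, Set.union_eq_right]
  induction hpq with
  | ax h => exact h.den_eq
  | @lfp_l p q r _ ih =>
    rw [le_iff] at ih ⊢
    rintro h h' ⟨y, hy, hh⟩
    obtain ⟨i, hi⟩ := mem_den_star.1 hy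
    clear hy
    induction i generalizing h with
    | zero => obtain rfl := hi; exact ih _ (Or.inl hh)
    | succ i ihi =>
      obtain ⟨x, hx, hi⟩ := hi
      exact ih _ (Or.inr ⟨x, hx, ihi _ hi⟩)
  | @lfp_r p q r _ ih =>
    rw [le_iff] at ih ⊢
    rintro h h' ⟨y, hy, hh⟩
    obtain ⟨i, hi⟩ := mem_den_star.1 hh
    clear hh
    induction i generalizing h' with
    | zero => obtain rfl := hi; exact ih _ (Or.inl hy)
    | succ i ihi =>
      rw [iter_succ_right] at hi
      obtain ⟨x, hx, hi⟩ := hi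
      exact ih _ (Or.inr ⟨x, ihi hx, hi⟩)
  | refl => rfl
  | symm _ ih => exact ih.symm
  | trans _ _ ih₁ ih₂ => exact ih₁.trans ih₂
  | add_congr _ _ ih₁ ih₂ => simp only [den, ih₁, ih₂]
  | mul_congr _ _ ih₁ ih₂ => simp only [den, ih₁, ih₂]
  | star_congr _ ih => simp only [den, ih]
  | neg_congr _ _ _ ih => simp only [den, ih]

end NetKAT

namespace NetKAT

variable {k : ℕ} {V : Fin k → Type u}

theorem isPolicy_sumList_test {f : Fin k} (l : List (V f)) :
    (sumList (l.map fun n => test f n)).IsPolicy := by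
  match l with
  | [] => trivial
  | [p] => trivial
  | p :: q :: l => exact ⟨trivial, isPolicy_sumList_test (q :: l)⟩

theorem IsPred.isPolicy {a : NetKAT V} (ha : a.IsPred) : a.IsPolicy := by
  induction a with
  | zero | one | test | dup => trivial
  | assign | star => exact ha.elim
  | neg a => exact ha
  | add a b iha ihb | mul a b iha ihb => exact ⟨iha ha.1, ihb ha.2⟩

/-! ### The Kleene algebra of policies modulo provable equality -/

section

variable [∀ f, Fintype (V f)]

/-- Provable equality of NetKAT policies. -/
def policySetoid (V : Fin k → Type u) [∀ f, Fintype (V f)] :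
    Setoid {p : NetKAT V // p.IsPolicy} where
  r p q := Provable p.1 q.1
  iseqv := ⟨fun p => .refl p.2, .symm, .trans⟩

/-- NetKAT policies modulo provable equality. -/
def PolicyClass (V : Fin k → Type u) [∀ f, Fintype (V f)] : Type u :=
  Quotient (policySetoid V)

/-- The class of a policy modulo provable equality. -/
def cls (p : NetKAT V) (hp : p.IsPolicy) : PolicyClass V := Quotient.mk (policySetoid V) ⟨p, hp⟩

theorem cls_eq_iff {p q : NetKAT V} {hp : p.IsPolicy} {hq : q.IsPolicy} :
    cls p hp = cls q hq ↔ Provable p q :=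
  ⟨fun h => Quotient.exact h, fun h => Quotient.sound h⟩

theorem PolicyClass.ind {P : PolicyClass V → Prop} (h : ∀ p hp, P (cls p hp)) (a) : P a :=
  Quotient.ind (fun p => h p.1 p.2) a

instance : Zero (PolicyClass V) := ⟨cls zero trivial⟩
instance : One (PolicyClass V) := ⟨cls one trivial⟩
instance : Add (PolicyClass V) := ⟨Quotient.map₂ (fun p q => ⟨add p.1 q.1, p.2, q.2⟩)
  fun _ _ h _ _ h' => Provable.add_congr h h'⟩
instance : Mul (PolicyClass V) := ⟨Quotient.map₂ (fun p q => ⟨mul p.1 q.1, p.2, q.2⟩)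
  fun _ _ h _ _ h' => Provable.mul_congr h h'⟩
instance : KStar (PolicyClass V) := ⟨Quotient.map (fun p => ⟨star p.1, p.2⟩)
  fun _ _ h => Provable.star_congr h⟩

theorem cls_add {p q : NetKAT V} (h : (add p q).IsPolicy) :
    cls (add p q) h = cls p h.1 + cls q h.2 := rfl
theorem cls_mul {p q : NetKAT V} (h : (mul p q).IsPolicy) :
    cls (mul p q) h = cls p h.1 * cls q h.2 := rfl
theorem cls_star {p : NetKAT V} (h : (star p).IsPolicy) :
    cls (star p) h = KStar.kstar (cls p h) := rfl

theorem Ax.cls_eq {p q : NetKAT V} (h : Ax p q) (hp : p.IsPolicy) (hq : q.IsPolicy) :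
    cls p hp = cls q hq := cls_eq_iff.2 (.ax h hp hq)

instance : Semiring (PolicyClass V) where
  add_assoc := by
    refine PolicyClass.ind fun p hp => PolicyClass.ind fun q hq => PolicyClass.ind fun r hr => ?_
    exact ((Ax.plus_assoc p q r).cls_eq ⟨hp, hq, hr⟩ ⟨⟨hp, hq⟩, hr⟩).symm
  zero_add := by
    refine PolicyClass.ind fun p hp => ?_
    exact ((Ax.plus_comm zero p).cls_eq ⟨trivial, hp⟩ ⟨hp, trivial⟩).trans
      ((Ax.plus_zero p).cls_eq ⟨hp, trivial⟩ hp)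
  add_zero := PolicyClass.ind fun p hp => (Ax.plus_zero p).cls_eq ⟨hp, trivial⟩ hp
  add_comm := by
    refine PolicyClass.ind fun p hp => PolicyClass.ind fun q hq => ?_
    exact (Ax.plus_comm p q).cls_eq ⟨hp, hq⟩ ⟨hq, hp⟩
  nsmul := nsmulRec
  left_distrib := by
    refine PolicyClass.ind fun p hp => PolicyClass.ind fun q hq => PolicyClass.ind fun r hr => ?_
    exact (Ax.seq_dist_l p q r).cls_eq ⟨hp, hq, hr⟩ ⟨⟨hp, hq⟩, hp, hr⟩
  right_distrib := by
    refine PolicyClass.ind fun p hp => PolicyClass.ind fun q hq => PolicyClass.ind fun r hr => ?_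
    exact (Ax.seq_dist_r p q r).cls_eq ⟨⟨hp, hq⟩, hr⟩ ⟨⟨hp, hr⟩, hq, hr⟩
  zero_mul := PolicyClass.ind fun p hp => (Ax.zero_seq p).cls_eq ⟨trivial, hp⟩ trivial
  mul_zero := PolicyClass.ind fun p hp => (Ax.seq_zero p).cls_eq ⟨hp, trivial⟩ trivial
  mul_assoc := by
    refine PolicyClass.ind fun p hp => PolicyClass.ind fun q hq => PolicyClass.ind fun r hr => ?_
    exact ((Ax.seq_assoc p q r).cls_eq ⟨hp, hq, hr⟩ ⟨⟨hp, hq⟩, hr⟩).symm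
  one_mul := PolicyClass.ind fun p hp => (Ax.one_seq p).cls_eq ⟨trivial, hp⟩ hp
  mul_one := PolicyClass.ind fun p hp => (Ax.seq_one p).cls_eq ⟨hp, trivial⟩ hp

instance : IdemSemiring (PolicyClass V) := .ofSemiring
  (PolicyClass.ind fun p hp => (Ax.plus_idem p).cls_eq ⟨hp, hp⟩ hp)

theorem one_add_mul_kstar_eq (a : PolicyClass V) :
    1 + a * KStar.kstar a = KStar.kstar a := by
  induction a using PolicyClass.ind with
  | h p hp => exact (Ax.unroll_l p).cls_eq ⟨trivial, hp, hp⟩ hp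

theorem one_add_kstar_mul_eq (a : PolicyClass V) :
    1 + KStar.kstar a * a = KStar.kstar a := by
  induction a using PolicyClass.ind with
  | h p hp => exact (Ax.unroll_r p).cls_eq ⟨trivial, hp, hp⟩ hp

instance : KleeneAlgebra (PolicyClass V) where
  one_le_kstar a := (add_le_iff.1 (one_add_mul_kstar_eq a).le).1
  mul_kstar_le_kstar a := (add_le_iff.1 (one_add_mul_kstar_eq a).le).2
  kstar_mul_le_kstar a := (add_le_iff.1 (one_add_kstar_mul_eq a).le).2
  mul_kstar_le_self := by
    refine PolicyClass.ind fun a ha => PolicyClass.ind fun b hb => fun h => ?_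
    -- The rule `lfp_r` is used with its additive term equal to `b` itself, which turns its premise
    -- into `b + b * a ≤ b`.
    have : cls (add (add b (mul b a)) b) ⟨⟨hb, hb, ha⟩, hb⟩ = cls b hb :=
      add_eq_right_iff_le.2 (add_le le_rfl h)
    exact add_eq_right_iff_le.1
      (cls_eq_iff (p := add (mul b (star a)) b) (hp := ⟨⟨hb, ha⟩, hb⟩) (hq := hb) |>.2
        (.lfp_r (cls_eq_iff.1 this)))
  kstar_mul_le_self := by
    refine PolicyClass.ind fun a ha => PolicyClass.ind fun b hb => fun h => ?_
    have : cls (add (add b (mul a b)) b) ⟨⟨hb, ha, hb⟩, hb⟩ = cls b hb :=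
      add_eq_right_iff_le.2 (add_le le_rfl h)
    exact add_eq_right_iff_le.1
      (cls_eq_iff (p := add (mul (star a) b) b) (hp := ⟨⟨ha, hb⟩, hb⟩) (hq := hb) |>.2
        (.lfp_l (cls_eq_iff.1 this)))

end

end NetKAT

/-! ### Finite sums as suprema in an idempotent semiring -/

theorem sum_le_iff_of_idemSemiring {α ι : Type*} [IdemSemiring α] {s : Finset ι} {f : ι → α}
    {c : α} : ∑ i ∈ s, f i ≤ c ↔ ∀ i ∈ s, f i ≤ c := by
  classical
  induction s using Finset.induction_on with
  | empty => simp
  | insert a s ha ih => rw [Finset.sum_insert ha, add_le_iff, ih, Finset.forall_mem_insert]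

theorem le_sum_of_idemSemiring {α ι : Type*} [IdemSemiring α] {s : Finset ι} (f : ι → α)
    {i : ι} (hi : i ∈ s) : f i ≤ ∑ i ∈ s, f i :=
  sum_le_iff_of_idemSemiring.1 le_rfl i hi

/-! ### Algebra of complete tests and complete assignments -/

namespace NetKAT

variable {k : ℕ} {V : Fin k → Type u} [∀ f, Fintype (V f)]

theorem cls_prodList {ι : Type*} (g : ι → NetKAT V) (hg : ∀ i, (g i).IsPolicy) (l : List ι)
    (h) : cls (prodList (l.map g)) h = (l.map fun i => cls (g i) (hg i)).prod := by
  match l with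
  | [] => rfl
  | [p] => simp [prodList]
  | p :: q :: l =>
    have ih := cls_prodList g hg (q :: l) h.2
    exact (congrArg (cls (g p) (hg p) * ·) ih).trans List.prod_cons.symm

theorem cls_sumList {ι : Type*} (g : ι → NetKAT V) (hg : ∀ i, (g i).IsPolicy) (l : List ι)
    (h) : cls (sumList (l.map g)) h = (l.map fun i => cls (g i) (hg i)).sum := by
  match l with
  | [] => rfl
  | [p] => simp [sumList]
  | p :: q :: l =>
    have ih := cls_sumList g hg (q :: l) h.2
    exact (congrArg (cls (g p) (hg p) + ·) ih).trans List.sum_cons.symm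

/-- The class of the test `f = n`. -/
def clsTest (f : Fin k) (n : V f) : PolicyClass V := cls (test f n) trivial

/-- The class of the assignment `f ← n`. -/
def clsAssign (f : Fin k) (n : V f) : PolicyClass V := cls (assign f n) trivial

/-- The class of the product of the tests `f = σ f` over the fields of a list. -/
def clsTests (l : List (Fin k)) (σ : Packet V) : PolicyClass V :=
  (l.map fun f => clsTest f (σ f)).prod

/-- The class of the product of the assignments `f ← σ f` over the fields of a list. -/
def clsAssigns (l : List (Fin k)) (σ : Packet V) : PolicyClass V :=
  (l.map fun f => clsAssign f (σ f)).prod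

theorem cls_completeTest (σ : Packet V) (h) :
    cls (completeTest σ) h = clsTests (List.finRange k) σ :=
  cls_prodList (fun f => test f (σ f)) (fun _ => trivial) _ h

theorem cls_completeAssign (σ : Packet V) (h) :
    cls (completeAssign σ) h = clsAssigns (List.finRange k) σ :=
  cls_prodList (fun f => assign f (σ f)) (fun _ => trivial) _ h

theorem sum_clsTest (f : Fin k) : ∑ n, clsTest f n = (1 : PolicyClass V) := by
  have := (Ax.match_all (V := V) f).cls_eq (isPolicy_sumList_test _) trivial
  unfold anyValue at this
  rw [cls_sumList (test f) (fun _ => trivial), Finset.sum_map_toList] at this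
  exact this

theorem clsTest_commute (f f' : Fin k) (n : V f) (n' : V f') :
    Commute (clsTest f n) (clsTest f' n') :=
  (Ax.pred_seq_comm (test f n) (test f' n') trivial trivial).cls_eq ⟨trivial, trivial⟩
    ⟨trivial, trivial⟩

theorem clsTest_mul_self (f : Fin k) (n : V f) : clsTest f n * clsTest f n = clsTest f n :=
  (Ax.seq_idem (test f n) trivial).cls_eq ⟨trivial, trivial⟩ trivial

theorem clsTest_mul_clsTest_of_ne {f : Fin k} {n n' : V f} (h : n ≠ n') :
    clsTest f n * clsTest f n' = 0 :=
  (Ax.filter_contra f n n' h).cls_eq ⟨trivial, trivial⟩ trivial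

theorem clsAssign_commute_clsTest {f f' : Fin k} (h : f ≠ f') (n : V f) (n' : V f') :
    Commute (clsAssign f n) (clsTest f' n') :=
  (Ax.mod_filter_comm f f' n n' h).cls_eq ⟨trivial, trivial⟩ ⟨trivial, trivial⟩

theorem clsAssign_commute {f f' : Fin k} (h : f ≠ f') (n : V f) (n' : V f') :
    Commute (clsAssign f n) (clsAssign f' n') :=
  (Ax.mod_mod_comm f f' n n' h).cls_eq ⟨trivial, trivial⟩ ⟨trivial, trivial⟩

theorem clsAssign_mul_clsTest (f : Fin k) (n : V f) :
    clsAssign f n * clsTest f n = clsAssign f n :=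
  (Ax.mod_filter f n).cls_eq ⟨trivial, trivial⟩ trivial

theorem clsTest_mul_clsAssign (f : Fin k) (n : V f) :
    clsTest f n * clsAssign f n = clsTest f n :=
  (Ax.filter_mod f n).cls_eq ⟨trivial, trivial⟩ trivial

theorem clsAssign_mul_clsAssign (f : Fin k) (n n' : V f) :
    clsAssign f n * clsAssign f n' = clsAssign f n' :=
  (Ax.mod_mod f n n').cls_eq ⟨trivial, trivial⟩ trivial

theorem clsTests_cons (f : Fin k) (l : List (Fin k)) (σ : Packet V) :
    clsTests (f :: l) σ = clsTest f (σ f) * clsTests l σ := by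
  simp [clsTests]

theorem clsAssigns_cons (f : Fin k) (l : List (Fin k)) (σ : Packet V) :
    clsAssigns (f :: l) σ = clsAssign f (σ f) * clsAssigns l σ := by
  simp [clsAssigns]

theorem clsTests_congr {l : List (Fin k)} {σ τ : Packet V} (h : ∀ f ∈ l, σ f = τ f) :
    clsTests l σ = clsTests l τ := by
  unfold clsTests
  congr 1
  exact List.map_congr_left fun f hf => by rw [h f hf]

theorem clsAssigns_congr {l : List (Fin k)} {σ τ : Packet V} (h : ∀ f ∈ l, σ f = τ f) :
    clsAssigns l σ = clsAssigns l τ := by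
  unfold clsAssigns
  congr 1
  exact List.map_congr_left fun f hf => by rw [h f hf]

theorem clsTests_commute_clsTest (l : List (Fin k)) (σ : Packet V) (f : Fin k) (n : V f) :
    Commute (clsTests l σ) (clsTest f n) :=
  Commute.list_prod_left _ _ fun x hx => by
    obtain ⟨g, -, rfl⟩ := List.mem_map.1 hx
    exact clsTest_commute ..

/-- The packet axioms commute a test with an assignment only on different fields, hence the
condition on `f`. -/
theorem clsTests_commute_clsAssign {l : List (Fin k)} (σ : Packet V) {f : Fin k} (n : V f)
    (hf : f ∉ l) : Commute (clsTests l σ) (clsAssign f n) :=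
  Commute.list_prod_left _ _ fun x hx => by
    obtain ⟨g, hg, rfl⟩ := List.mem_map.1 hx
    exact (clsAssign_commute_clsTest (by rintro rfl; exact hf hg) ..).symm

theorem clsAssigns_commute_clsTest {l : List (Fin k)} (σ : Packet V) {f : Fin k} (n : V f)
    (hf : f ∉ l) : Commute (clsAssigns l σ) (clsTest f n) :=
  Commute.list_prod_left _ _ fun x hx => by
    obtain ⟨g, hg, rfl⟩ := List.mem_map.1 hx
    exact clsAssign_commute_clsTest (by rintro rfl; exact hf hg) ..

theorem clsAssigns_commute_clsAssign {l : List (Fin k)} (σ : Packet V) {f : Fin k} (n : V f)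
    (hf : f ∉ l) : Commute (clsAssigns l σ) (clsAssign f n) :=
  Commute.list_prod_left _ _ fun x hx => by
    obtain ⟨g, hg, rfl⟩ := List.mem_map.1 hx
    exact clsAssign_commute (by rintro rfl; exact hf hg) ..

theorem clsTests_mul_clsTest_self {l : List (Fin k)} (σ : Packet V) {f : Fin k} (hf : f ∈ l) :
    clsTests l σ * clsTest f (σ f) = clsTests l σ := by
  induction l with
  | nil => simp at hf
  | cons g l ih =>
    rw [clsTests_cons, mul_assoc]
    by_cases hg : f = g
    · subst hg
      rw [(clsTests_commute_clsTest ..).eq, ← mul_assoc, clsTest_mul_self]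
    · rw [ih ((List.mem_cons.1 hf).resolve_left hg)]

theorem clsTests_mul_clsTest_of_ne {l : List (Fin k)} {σ : Packet V} {f : Fin k} (hf : f ∈ l)
    {n : V f} (hn : σ f ≠ n) : clsTests l σ * clsTest f n = 0 := by
  rw [← clsTests_mul_clsTest_self σ hf, mul_assoc, clsTest_mul_clsTest_of_ne hn, mul_zero]

theorem clsTests_mul_clsTests_of_ne {l : List (Fin k)} {σ τ : Packet V} {f : Fin k} (hf : f ∈ l)
    (hn : σ f ≠ τ f) : clsTests l σ * clsTests l τ = 0 := by
  rw [← clsTests_mul_clsTest_self τ hf, (clsTests_commute_clsTest ..).eq, ← mul_assoc,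
    clsTests_mul_clsTest_of_ne hf hn, zero_mul]

/-- Since no field repeats, the first assignment moves left past the tests of the other fields,
meets its own test and is absorbed by it. -/
theorem clsTests_mul_clsAssigns {l : List (Fin k)} (hl : l.Nodup) (σ : Packet V) :
    clsTests l σ * clsAssigns l σ = clsTests l σ := by
  induction l with
  | nil => simp [clsTests, clsAssigns]
  | cons f l ih =>
    rw [List.nodup_cons] at hl
    rw [clsTests_cons, clsAssigns_cons, mul_assoc, ← mul_assoc (clsTests l σ),
      (clsTests_commute_clsAssign σ _ hl.1).eq, mul_assoc, ih hl.2, ← mul_assoc,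
      clsTest_mul_clsAssign]

theorem clsAssigns_mul_clsTests {l : List (Fin k)} (hl : l.Nodup) (σ : Packet V) :
    clsAssigns l σ * clsTests l σ = clsAssigns l σ := by
  induction l with
  | nil => simp [clsTests, clsAssigns]
  | cons f l ih =>
    rw [List.nodup_cons] at hl
    rw [clsTests_cons, clsAssigns_cons, mul_assoc, ← mul_assoc (clsAssigns l σ),
      (clsAssigns_commute_clsTest σ _ hl.1).eq, mul_assoc, ih hl.2, ← mul_assoc,
      clsAssign_mul_clsTest]

theorem clsAssigns_mul_clsAssign {l : List (Fin k)} (hl : l.Nodup) (σ : Packet V) {f : Fin k}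
    (hf : f ∈ l) (n : V f) :
    clsAssigns l σ * clsAssign f n = clsAssigns l (Function.update σ f n) := by
  induction l with
  | nil => simp at hf
  | cons g l ih =>
    rw [List.nodup_cons] at hl
    rw [clsAssigns_cons, clsAssigns_cons, mul_assoc]
    by_cases hg : f = g
    · subst hg
      rw [(clsAssigns_commute_clsAssign σ n hl.1).eq, ← mul_assoc, clsAssign_mul_clsAssign,
        Function.update_self]
      congr 1
      exact clsAssigns_congr fun f' hf' =>
        (Function.update_of_ne (by rintro rfl; exact hl.1 hf') _ _).symm
    · rw [ih hl.2 ((List.mem_cons.1 hf).resolve_left hg), Function.update_of_ne (Ne.symm hg)]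

/-- The right-hand list is a separate sublist so that the induction can shrink it while the
left-hand product keeps all its fields. -/
theorem clsAssigns_mul_clsAssigns {l l' : List (Fin k)} (hl : l.Nodup) (h : l' ⊆ l)
    (σ τ : Packet V) :
    clsAssigns l σ * clsAssigns l' τ = clsAssigns l fun f => if f ∈ l' then τ f else σ f := by
  induction l' generalizing σ with
  | nil => simp [clsAssigns]
  | cons f l' ih =>
    rw [clsAssigns_cons, ← mul_assoc, clsAssigns_mul_clsAssign hl σ (h List.mem_cons_self),
      ih fun x hx => h (List.mem_cons_of_mem _ hx)]
    refine clsAssigns_congr fun g _ => ?_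
    by_cases hg : g = f
    · subst hg; simp
    · simp [hg]

/-- The class of the complete test for `σ`. -/
def clsCompleteTest (σ : Packet V) : PolicyClass V := clsTests (List.finRange k) σ

/-- The class of the complete assignment for `σ`. -/
def clsCompleteAssign (σ : Packet V) : PolicyClass V := clsAssigns (List.finRange k) σ

theorem clsCompleteTest_mul_clsTest (σ : Packet V) (f : Fin k) :
    clsCompleteTest σ * clsTest f (σ f) = clsCompleteTest σ :=
  clsTests_mul_clsTest_self σ (List.mem_finRange f)

theorem clsCompleteTest_mul_clsTest_of_ne {σ : Packet V} {f : Fin k} {n : V f} (h : σ f ≠ n) :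
    clsCompleteTest σ * clsTest f n = 0 :=
  clsTests_mul_clsTest_of_ne (List.mem_finRange f) h

theorem clsCompleteTest_mul_of_ne {σ τ : Packet V} (h : σ ≠ τ) :
    clsCompleteTest σ * clsCompleteTest τ = 0 := by
  obtain ⟨f, hf⟩ := Function.ne_iff.1 h
  exact clsTests_mul_clsTests_of_ne (List.mem_finRange f) hf

theorem clsCompleteTest_mul_clsCompleteAssign (σ : Packet V) :
    clsCompleteTest σ * clsCompleteAssign σ = clsCompleteTest σ :=
  clsTests_mul_clsAssigns (List.nodup_finRange k) σ

theorem clsCompleteAssign_mul_clsCompleteTest (σ : Packet V) :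
    clsCompleteAssign σ * clsCompleteTest σ = clsCompleteAssign σ :=
  clsAssigns_mul_clsTests (List.nodup_finRange k) σ

theorem clsCompleteAssign_mul_clsAssign (σ : Packet V) (f : Fin k) (n : V f) :
    clsCompleteAssign σ * clsAssign f n = clsCompleteAssign (Function.update σ f n) :=
  clsAssigns_mul_clsAssign (List.nodup_finRange k) σ (List.mem_finRange f) n

theorem clsCompleteAssign_mul (σ τ : Packet V) :
    clsCompleteAssign σ * clsCompleteAssign τ = clsCompleteAssign τ := by
  refine (clsAssigns_mul_clsAssigns (List.nodup_finRange k) (List.Subset.refl _) σ τ).trans ?_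
  exact clsAssigns_congr fun f hf => by simp

theorem clsTest_le_one (f : Fin k) (n : V f) : clsTest f n ≤ 1 := by
  rw [← sum_clsTest f]
  exact le_sum_of_idemSemiring _ (Finset.mem_univ n)

theorem clsCompleteTest_le_one (σ : Packet V) : clsCompleteTest σ ≤ 1 := by
  have key : ∀ l : List (Fin k), clsTests l σ ≤ 1 := by
    intro l
    induction l with
    | nil => exact le_rfl
    | cons f l ih =>
      rw [clsTests_cons]
      exact mul_le_one' (clsTest_le_one ..) ih
  exact key _

/-- The unit is expanded one field at a time, by inserting the sum of all tests of that field. -/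
theorem one_le_sum_clsCompleteTest [∀ f, Nonempty (V f)] :
    (1 : PolicyClass V) ≤ ∑ σ, clsCompleteTest σ := by
  -- `l'` is the final segment of the fields already tested and `l` lists, in reverse, those still
  -- to be inserted. With `l` empty the product is a complete test; with `l'` empty it is `1`.
  have key : ∀ l l' : List (Fin k), l.reverse ++ l' = List.finRange k → ∀ σ : Packet V,
      clsTests l' σ ≤ ∑ σ, clsCompleteTest σ := by
    intro l
    induction l with
    | nil =>
      rintro l' rfl σ
      exact le_sum_of_idemSemiring clsCompleteTest (Finset.mem_univ σ)
    | cons f l ih =>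
      intro l' h σ
      have hf : f ∉ l' := by
        have := List.nodup_finRange k
        rw [← h] at this
        simp only [List.reverse_cons, List.append_assoc, List.singleton_append] at this
        exact (List.nodup_cons.1 (List.nodup_append.1 this).2.1).1
      rw [← one_mul (clsTests l' σ), ← sum_clsTest f, Finset.sum_mul, sum_le_iff_of_idemSemiring]
      intro n _
      have := ih (f :: l') (by simpa using h) (Function.update σ f n)
      rwa [clsTests_cons, Function.update_self, clsTests_congr (τ := σ)] at this
      exact fun g hg => Function.update_of_ne (by rintro rfl; exact hf hg) _ _
  simpa [clsTests] using key (List.finRange k).reverse [] (by simp)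
    (fun f => Classical.arbitrary (V f))

theorem sum_clsCompleteTest : ∑ σ, clsCompleteTest σ = (1 : PolicyClass V) := by
  refine le_antisymm (sum_le_iff_of_idemSemiring.2 fun σ _ => clsCompleteTest_le_one σ) ?_
  by_cases h : ∀ f, Nonempty (V f)
  · exact one_le_sum_clsCompleteTest
  -- A field without values makes the sum of its tests empty, so `1 = 0`.
  · obtain ⟨f, hf⟩ := not_forall.1 h
    rw [not_nonempty_iff] at hf
    rw [← sum_clsTest f, Finset.univ_eq_empty, Finset.sum_empty]
    exact zero_le

/-! ### Normal forms of `dup`-free policies -/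

open Classical in
/-- The sum of the classes of `α · π` over the pairs of packets in a relation. -/
noncomputable def relClass (R : Packet V → Packet V → Prop) : PolicyClass V :=
  ∑ x : Packet V × Packet V with R x.1 x.2, clsCompleteTest x.1 * clsCompleteAssign x.2

theorem relClass_le_iff {R : Packet V → Packet V → Prop} {c : PolicyClass V} :
    relClass R ≤ c ↔ ∀ σ τ, R σ τ → clsCompleteTest σ * clsCompleteAssign τ ≤ c := by
  simp [relClass, sum_le_iff_of_idemSemiring]

theorem le_relClass {R : Packet V → Packet V → Prop} {σ τ : Packet V} (h : R σ τ) :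
    clsCompleteTest σ * clsCompleteAssign τ ≤ relClass R :=
  relClass_le_iff.1 le_rfl σ τ h

theorem flow_mul_flow (σ τ υ : Packet V) :
    (clsCompleteTest σ * clsCompleteAssign τ) * (clsCompleteTest τ * clsCompleteAssign υ) =
      clsCompleteTest σ * clsCompleteAssign υ := by
  rw [mul_assoc, ← mul_assoc (clsCompleteAssign τ), clsCompleteAssign_mul_clsCompleteTest,
    clsCompleteAssign_mul]

/-- A complete assignment for `τ` implies the complete test for `τ`, which contradicts the one for
`τ'`. -/
theorem flow_mul_flow_of_ne (σ : Packet V) {τ τ' : Packet V} (h : τ ≠ τ') (υ : Packet V) :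
    (clsCompleteTest σ * clsCompleteAssign τ) * (clsCompleteTest τ' * clsCompleteAssign υ) = 0 := by
  rw [← clsCompleteAssign_mul_clsCompleteTest τ, mul_assoc, mul_assoc (clsCompleteAssign τ),
    ← mul_assoc (clsCompleteTest τ), clsCompleteTest_mul_of_ne h, zero_mul, mul_zero, mul_zero]

theorem relClass_add (R S : Packet V → Packet V → Prop) :
    relClass R + relClass S = relClass fun σ τ => R σ τ ∨ S σ τ := by
  refine le_antisymm (add_le ?_ ?_) (relClass_le_iff.2 fun σ τ h => ?_)
  · exact relClass_le_iff.2 fun σ τ h => le_relClass (Or.inl h)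
  · exact relClass_le_iff.2 fun σ τ h => le_relClass (Or.inr h)
  · rcases h with h | h
    · exact (le_relClass h).trans (add_le_iff.1 le_rfl).1
    · exact (le_relClass h).trans (add_le_iff.1 le_rfl).2

theorem relClass_mul (R S : Packet V → Packet V → Prop) :
    relClass R * relClass S = relClass (Relation.Comp R S) := by
  refine le_antisymm ?_ (relClass_le_iff.2 ?_)
  · conv_lhs => rw [relClass, relClass, Finset.sum_mul_sum]
    refine sum_le_iff_of_idemSemiring.2 fun x hx => sum_le_iff_of_idemSemiring.2 fun y hy => ?_
    simp only [Finset.mem_filter, Finset.mem_univ, true_and] at hx hy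
    by_cases h : x.2 = y.1
    · rw [← h] at hy ⊢
      rw [flow_mul_flow]
      exact le_relClass ⟨x.2, hx, hy⟩
    · rw [flow_mul_flow_of_ne _ h]
      exact zero_le
  · rintro σ υ ⟨τ, h, h'⟩
    rw [← flow_mul_flow σ τ υ]
    exact mul_le_mul' (le_relClass h) (le_relClass h')

theorem sum_clsCompleteTest_filter (s : Set (Packet V)) [DecidablePred (· ∈ s)] :
    ∑ σ with σ ∈ s, clsCompleteTest σ = relClass fun σ τ => σ = τ ∧ σ ∈ s := by
  refine le_antisymm (sum_le_iff_of_idemSemiring.2 fun σ h => ?_) (relClass_le_iff.2 ?_)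
  · rw [← clsCompleteTest_mul_clsCompleteAssign]
    exact le_relClass ⟨rfl, by simpa using h⟩
  · rintro σ _ ⟨rfl, h⟩
    rw [clsCompleteTest_mul_clsCompleteAssign]
    exact le_sum_of_idemSemiring _ (by simpa using h)

theorem relClass_eq : relClass (V := V) (· = ·) = 1 := by
  classical
  have := sum_clsCompleteTest_filter (V := V) Set.univ
  simpa [sum_clsCompleteTest] using this.symm

/-- The upper bound is the star induction rule: the closure contains the identity and absorbs `R` on
the left. The lower bound is built along a path, each further step being absorbed by the star. -/
theorem kstar_relClass (R : Packet V → Packet V → Prop) :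
    KStar.kstar (relClass R) = relClass (Relation.ReflTransGen R) := by
  refine le_antisymm (kstar_le_of_mul_le_right ?_ ?_) (relClass_le_iff.2 fun σ τ h => ?_)
  · rw [← relClass_eq, relClass_le_iff]
    rintro σ _ rfl
    exact le_relClass .refl
  · rw [relClass_mul, relClass_le_iff]
    rintro σ τ ⟨υ, h, h'⟩
    exact le_relClass (.head h h')
  · induction h with
    | refl =>
      rw [clsCompleteTest_mul_clsCompleteAssign]
      exact (clsCompleteTest_le_one σ).trans one_le_kstar
    | @tail τ υ _ h ih =>
      rw [← flow_mul_flow σ τ υ]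
      exact (mul_le_mul' ih (le_relClass h)).trans kstar_mul_le_kstar

/-- A complete test fixes every field, so it decides each predicate: it either implies it or
excludes it. For a negation, excluded middle and contradiction exchange the two cases. -/
theorem clsCompleteTest_mul_cls_of_isPred {a : NetKAT V} (ha : a.IsPred) (σ : Packet V) :
    clsCompleteTest σ * cls a ha.isPolicy = clsCompleteTest σ ∨
      clsCompleteTest σ * cls a ha.isPolicy = 0 := by
  induction a with
  | zero => exact Or.inr (mul_zero _)
  | one => exact Or.inl (mul_one _)
  | test f n =>
    by_cases h : σ f = n
    · subst h
      exact Or.inl (clsCompleteTest_mul_clsTest σ f)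
    · exact Or.inr (clsCompleteTest_mul_clsTest_of_ne h)
  | neg a ih =>
    have h1 : cls a (IsPred.isPolicy ha) + cls (neg a) ha = 1 :=
      (Ax.excl_mid a ha).cls_eq ⟨IsPred.isPolicy ha, ha⟩ trivial
    have h2 : cls a (IsPred.isPolicy ha) * cls (neg a) ha = 0 :=
      (Ax.contra a ha).cls_eq ⟨IsPred.isPolicy ha, ha⟩ trivial
    rcases ih ha with h | h
    · right
      rw [← h, mul_assoc, h2, mul_zero]
    · left
      conv_rhs => rw [← mul_one (clsCompleteTest σ), ← h1, mul_add, h, zero_add]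
  | assign | star | dup => exact ha.elim
  | add a b iha ihb =>
    rw [cls_add, mul_add]
    rcases iha ha.1 with h | h <;> rcases ihb ha.2 with h' | h' <;> simp [h, h', add_eq_sup]
  | mul a b iha ihb =>
    rw [cls_mul, ← mul_assoc]
    rcases iha ha.1 with h | h <;> rcases ihb ha.2 with h' | h' <;> simp [h, h']

/-- Multiplying the partition of unity by `a` keeps exactly the complete tests that imply `a`. -/
theorem exists_relClass_eq_of_isPred {a : NetKAT V} (ha : a.IsPred) :
    ∃ R, cls a ha.isPolicy = relClass R := by
  classical
  refine ⟨_, Eq.trans ?_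
    (sum_clsCompleteTest_filter {σ | clsCompleteTest σ * cls a ha.isPolicy = clsCompleteTest σ})⟩
  have h := congrArg (· * cls a ha.isPolicy) (sum_clsCompleteTest (V := V))
  simp only [one_mul, Finset.sum_mul] at h
  rw [Finset.sum_filter]
  refine h.symm.trans ?_
  refine Finset.sum_congr rfl fun σ _ => ?_
  split_ifs with h
  · exact h
  · exact (clsCompleteTest_mul_cls_of_isPred ha σ).resolve_left h

theorem exists_relClass_eq {z : NetKAT V} (hz : z.IsPolicy) (hd : z.DupFree) :
    ∃ R, cls z hz = relClass R := by
  induction z with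
  | zero => exact exists_relClass_eq_of_isPred (a := zero) trivial
  | one => exact exists_relClass_eq_of_isPred (a := one) trivial
  | test f n => exact exists_relClass_eq_of_isPred (a := test f n) trivial
  | neg a => exact exists_relClass_eq_of_isPred (a := neg a) hz
  | assign f n =>
    refine ⟨fun σ τ => τ = Function.update σ f n, le_antisymm ?_ (relClass_le_iff.2 ?_)⟩
    · rw [← one_mul (cls _ _), ← sum_clsCompleteTest, Finset.sum_mul, sum_le_iff_of_idemSemiring]
      intro σ _
      -- After the test for `σ`, assigning the values of `σ` changes nothing; inserting that
      -- assignment lets `f ← n` merge into it.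
      rw [← clsCompleteTest_mul_clsCompleteAssign, mul_assoc]
      exact (congrArg _ (clsCompleteAssign_mul_clsAssign σ f n)).trans_le
        (le_relClass (R := fun σ τ => τ = Function.update σ f n) rfl)
    · rintro σ _ rfl
      rw [← clsCompleteAssign_mul_clsAssign, ← mul_assoc, clsCompleteTest_mul_clsCompleteAssign]
      exact mul_le_of_le_one_left' (clsCompleteTest_le_one σ)
  | add p q ihp ihq =>
    obtain ⟨R, hR⟩ := ihp hz.1 hd.1
    obtain ⟨S, hS⟩ := ihq hz.2 hd.2
    exact ⟨_, by rw [cls_add, hR, hS, relClass_add]⟩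
  | mul p q ihp ihq =>
    obtain ⟨R, hR⟩ := ihp hz.1 hd.1
    obtain ⟨S, hS⟩ := ihq hz.2 hd.2
    exact ⟨_, by rw [cls_mul, hR, hS, relClass_mul]⟩
  | star p ih =>
    obtain ⟨R, hR⟩ := ih hz hd
    exact ⟨_, by rw [cls_star, hR, kstar_relClass]⟩
  | dup => exact hd.elim

end NetKAT

/-! ### Policies as finite sums of flows -/

namespace Pol

variable {k : ℕ} {V : Fin k → Type u}

/-- The sum of the policies `α · π` over a list of pairs of packets. -/
def flows (l : List (Packet V × Packet V)) : Pol V :=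
  l.foldr (fun x z => add (flow x.1 x.2) z) zero

open NetKAT in
theorem exists_provable_flows [∀ f, Fintype (V f)] (z : Pol V) :
    ∃ l, NetKAT.Provable z.1 (flows l).1 := by
  classical
  obtain ⟨R, hR⟩ := exists_relClass_eq z.2.1 z.2.2
  have key : ∀ l : List (Packet V × Packet V), cls (flows l).1 (flows l).2.1 =
      (l.map fun x => clsCompleteTest x.1 * clsCompleteAssign x.2).sum := by
    intro l
    induction l with
    | nil => rfl
    | cons x l ih =>
      rw [List.map_cons, List.sum_cons, ← ih, clsCompleteTest, clsCompleteAssign,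
        ← cls_completeTest x.1 (completeTest_mem _).1,
        ← cls_completeAssign x.2 (completeAssign_mem _).1]
      rfl
  refine ⟨(Finset.univ.filter fun x : Packet V × Packet V => R x.1 x.2).toList, ?_⟩
  rw [← cls_eq_iff (hp := z.2.1) (hq := (flows _).2.1), hR, key, Finset.sum_map_toList, relClass]

end Pol

/-! ### Bisimilarity -/

section

variable {k : ℕ} {V : Fin k → Type u} {C : Type v} {X : Type w} {E : X → Policy V C X}

open Policy

/-- Every transition of `p` is matched by a transition of `q` into an `R`-related policy. -/
def Simulates (E : X → Policy V C X) (R : Policy V C X → Policy V C X → Prop)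
    (p q : Policy V C X) : Prop :=
  ∀ H₀ H₁ γ p' H₀' H₁', Step E p H₀ H₁ γ p' H₀' H₁' → ∃ q', Step E q H₀ H₁ γ q' H₀' H₁' ∧ R p' q'

theorem Simulates.mono {R S : Policy V C X → Policy V C X → Prop} {p q : Policy V C X}
    (h : Simulates E R p q) (hRS : ∀ p q, R p q → S p q) : Simulates E S p q :=
  fun _ _ _ _ _ _ hs =>
    let ⟨q', hq, hR⟩ := h _ _ _ _ _ _ hs
    ⟨q', hq, hRS _ _ hR⟩

theorem Bisimilar.symm {p q : Policy V C X} (h : Bisimilar E p q) : Bisimilar E q p :=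
  let ⟨R, hR, hpq⟩ := h
  ⟨R, hR, hR.1 _ _ hpq⟩

theorem Bisimilar.simulates {p q : Policy V C X} (h : Bisimilar E p q) :
    Simulates E (Bisimilar E) p q := by
  obtain ⟨R, hR, hpq⟩ := h
  exact Simulates.mono (hR.2 _ _ hpq) fun _ _ h => ⟨R, hR, h⟩

/-- A coinduction principle up to bisimilarity: successors may leave `R` as long as they are already
known to be bisimilar. -/
theorem Bisimilar.of_symm_rel (R : Policy V C X → Policy V C X → Prop)
    (hs : ∀ p q, R p q → R q p)
    (hR : ∀ p q, R p q → Simulates E (fun p q => R p q ∨ Bisimilar E p q) p q)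
    {p q : Policy V C X} (h : R p q) : Bisimilar E p q := by
  refine ⟨fun p q => R p q ∨ Bisimilar E p q, ⟨?_, ?_⟩, Or.inl h⟩
  · exact fun p q h => h.imp (hs p q) Bisimilar.symm
  · rintro p q (h | h)
    · exact hR p q h
    · exact h.simulates.mono fun _ _ => Or.inr

theorem Bisimilar.intro {p q : Policy V C X} (h : Simulates E (Bisimilar E) p q)
    (h' : Simulates E (Bisimilar E) q p) : Bisimilar E p q := by
  refine Bisimilar.of_symm_rel (fun a b => (a = p ∧ b = q) ∨ (a = q ∧ b = p)) ?_ ?_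
    (Or.inl ⟨rfl, rfl⟩)
  · rintro a b (⟨rfl, rfl⟩ | ⟨rfl, rfl⟩) <;> simp
  · rintro a b (⟨rfl, rfl⟩ | ⟨rfl, rfl⟩)
    · exact h.mono fun _ _ => Or.inr
    · exact h'.mono fun _ _ => Or.inr

theorem Bisimilar.refl (p : Policy V C X) : Bisimilar E p p :=
  .of_symm_rel (· = ·) (fun _ _ => Eq.symm)
    (by rintro p _ rfl; exact fun _ _ _ p' _ _ hs => ⟨p', hs, Or.inl rfl⟩) rfl

theorem Bisimilar.trans {p q r : Policy V C X} (h : Bisimilar E p q) (h' : Bisimilar E q r) :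
    Bisimilar E p r := by
  refine .of_symm_rel (fun p r => ∃ q, Bisimilar E p q ∧ Bisimilar E q r) ?_ ?_ ⟨q, h, h'⟩
  · rintro p r ⟨q, h, h'⟩
    exact ⟨q, h'.symm, h.symm⟩
  · rintro p r ⟨q, h, h'⟩ _ _ _ _ _ _ hs
    obtain ⟨q', hq, hpq⟩ := h.simulates _ _ _ _ _ _ hs
    obtain ⟨r', hr, hqr⟩ := h'.simulates _ _ _ _ _ _ hq
    exact ⟨r', hr, Or.inl ⟨q', hpq, hqr⟩⟩

/-- This covers the axioms whose two sides have identical successors, with no relation to be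
exhibited. -/
theorem Bisimilar.intro_eq {p q : Policy V C X} (h : ∀ H₀ H₁ γ p' H₀' H₁',
    Step E p H₀ H₁ γ p' H₀' H₁' ↔ Step E q H₀ H₁ γ p' H₀' H₁') : Bisimilar E p q :=
  .intro (fun _ _ _ _ _ _ hs => ⟨_, (h ..).1 hs, .refl _⟩)
    (fun _ _ _ _ _ _ hs => ⟨_, (h ..).2 hs, .refl _⟩)

/-! #### Congruence -/

theorem Bisimilar.pre (a : Act V C) {p p' : Policy V C X} (h : Bisimilar E p p') :
    Bisimilar E (pre a p) (pre a p') := by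
  have key : ∀ p p', Bisimilar E p p' → Simulates E (Bisimilar E) (.pre a p) (.pre a p') := by
    intro p p' h _ _ _ _ _ _ hs
    cases hs with
    | pol hz => exact ⟨_, .pol hz, h⟩
    | comm => exact ⟨_, .comm, h⟩
    | rcfg => exact ⟨_, .rcfg, h⟩
  exact .intro (key _ _ h) (key _ _ h.symm)

theorem Bisimilar.choice {p p' q q' : Policy V C X} (hp : Bisimilar E p p')
    (hq : Bisimilar E q q') : Bisimilar E (choice p q) (choice p' q') := by
  have key : ∀ p p' q q', Bisimilar E p p' → Bisimilar E q q' →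
      Simulates E (Bisimilar E) (.choice p q) (.choice p' q') := by
    intro p p' q q' hp hq _ _ _ _ _ _ hs
    cases hs with
    | choice_l hs =>
      obtain ⟨r, hr, h⟩ := hp.simulates _ _ _ _ _ _ hs
      exact ⟨r, .choice_l hr, h⟩
    | choice_r hs =>
      obtain ⟨r, hr, h⟩ := hq.simulates _ _ _ _ _ _ hs
      exact ⟨r, .choice_r hr, h⟩
  exact .intro (key _ _ _ _ hp hq) (key _ _ _ _ hp.symm hq.symm)

theorem Bisimilar.par {p p' q q' : Policy V C X} (hp : Bisimilar E p p')
    (hq : Bisimilar E q q') : Bisimilar E (par p q) (par p' q') := by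
  refine .of_symm_rel (fun a b => ∃ p p' q q', a = .par p q ∧ b = .par p' q' ∧
    Bisimilar E p p' ∧ Bisimilar E q q') ?_ ?_ ⟨p, p', q, q', rfl, rfl, hp, hq⟩
  · rintro _ _ ⟨p, p', q, q', rfl, rfl, hp, hq⟩
    exact ⟨_, _, _, _, rfl, rfl, hp.symm, hq.symm⟩
  · rintro _ _ ⟨p, p', q, q', rfl, rfl, hp, hq⟩ _ _ _ _ _ _ hs
    cases hs with
    | par_l hs =>
      obtain ⟨r, hr, h⟩ := hp.simulates _ _ _ _ _ _ hs
      exact ⟨_, .par_l hr, Or.inl ⟨_, _, _, _, rfl, rfl, h, hq⟩⟩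
    | par_r hs =>
      obtain ⟨r, hr, h⟩ := hq.simulates _ _ _ _ _ _ hs
      exact ⟨_, .par_r hr, Or.inl ⟨_, _, _, _, rfl, rfl, hp, h⟩⟩
    | par_send_recv h₁ h₂ =>
      obtain ⟨r, hr, h⟩ := hp.simulates _ _ _ _ _ _ h₁
      obtain ⟨s, hs, h'⟩ := hq.simulates _ _ _ _ _ _ h₂
      exact ⟨_, .par_send_recv hr hs, Or.inl ⟨_, _, _, _, rfl, rfl, h, h'⟩⟩
    | par_recv_send h₁ h₂ =>
      obtain ⟨r, hr, h⟩ := hp.simulates _ _ _ _ _ _ h₁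
      obtain ⟨s, hs, h'⟩ := hq.simulates _ _ _ _ _ _ h₂
      exact ⟨_, .par_recv_send hr hs, Or.inl ⟨_, _, _, _, rfl, rfl, h, h'⟩⟩

theorem Bisimilar.delta (L : Set (Comm V C)) {p p' : Policy V C X} (hp : Bisimilar E p p') :
    Bisimilar E (delta L p) (delta L p') := by
  refine .of_symm_rel (fun a b => ∃ p p', a = .delta L p ∧ b = .delta L p' ∧
    Bisimilar E p p') ?_ ?_ ⟨p, p', rfl, rfl, hp⟩
  · rintro _ _ ⟨p, p', rfl, rfl, hp⟩
    exact ⟨_, _, rfl, rfl, hp.symm⟩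
  · rintro _ _ ⟨p, p', rfl, rfl, hp⟩ _ _ _ _ _ _ hs
    cases hs with
    | delta hs hL =>
      obtain ⟨r, hr, h⟩ := hp.simulates _ _ _ _ _ _ hs
      exact ⟨_, .delta hr hL, Or.inl ⟨_, _, rfl, rfl, h⟩⟩

/-- A step lowers both depths by one, so the relation has to range over all pairs `m ≤ n`. -/
theorem Bisimilar.proj_of_le {m n : ℕ} (hmn : m ≤ n) {p p' : Policy V C X}
    (hp : Bisimilar E (proj n p) (proj n p')) : Bisimilar E (proj m p) (proj m p') := by
  refine .of_symm_rel (fun a b => ∃ m n p p', m ≤ n ∧ a = .proj m p ∧ b = .proj m p' ∧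
    Bisimilar E (.proj n p) (.proj n p')) ?_ ?_ ⟨m, n, p, p', hmn, rfl, rfl, hp⟩
  · rintro _ _ ⟨m, n, p, p', hmn, rfl, rfl, hp⟩
    exact ⟨_, _, _, _, hmn, rfl, rfl, hp.symm⟩
  · rintro _ _ ⟨m, n, p, p', hmn, rfl, rfl, hp⟩ _ _ _ _ _ _ hs
    cases hs with
    | @proj m _ _ _ _ _ _ _ hs =>
      -- The smaller depth is now a successor, as `π₀` has no transitions; hence so is the larger
      -- one.
      obtain ⟨n, rfl⟩ : ∃ i, n = i + 1 := ⟨n - 1, by omega⟩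
      obtain ⟨r, hr, h⟩ := hp.simulates _ _ _ _ _ _ (.proj hs)
      cases hr with
      | proj hr => exact ⟨_, .proj hr, Or.inl ⟨m, n, _, _, by omega, rfl, rfl, h⟩⟩

theorem Bisimilar.proj (n : ℕ) {p p' : Policy V C X} (hp : Bisimilar E p p') :
    Bisimilar E (proj n p) (proj n p') := by
  refine .of_symm_rel (fun a b => ∃ n p p', a = .proj n p ∧ b = .proj n p' ∧
    Bisimilar E p p') ?_ ?_ ⟨n, p, p', rfl, rfl, hp⟩
  · rintro _ _ ⟨n, p, p', rfl, rfl, hp⟩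
    exact ⟨_, _, _, rfl, rfl, hp.symm⟩
  · rintro _ _ ⟨n, p, p', rfl, rfl, hp⟩ _ _ _ _ _ _ hs
    cases hs with
    | proj hs =>
      obtain ⟨r, hr, h⟩ := hp.simulates _ _ _ _ _ _ hs
      exact ⟨_, .proj hr, Or.inl ⟨_, _, _, rfl, rfl, h⟩⟩

theorem Bisimilar.lmerge {p p' q q' : Policy V C X} (hp : Bisimilar E p p')
    (hq : Bisimilar E q q') : Bisimilar E (lmerge p q) (lmerge p' q') := by
  have key : ∀ p p' q q', Bisimilar E p p' → Bisimilar E q q' →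
      Simulates E (Bisimilar E) (.lmerge p q) (.lmerge p' q') := by
    intro p p' q q' hp hq _ _ _ _ _ _ hs
    cases hs with
    | lmerge hs =>
      obtain ⟨r, hr, h⟩ := hp.simulates _ _ _ _ _ _ hs
      exact ⟨_, .lmerge hr, h.par hq⟩
  exact .intro (key _ _ _ _ hp hq) (key _ _ _ _ hp.symm hq.symm)

theorem Bisimilar.cmerge {p p' q q' : Policy V C X} (hp : Bisimilar E p p')
    (hq : Bisimilar E q q') : Bisimilar E (cmerge p q) (cmerge p' q') := by
  have key : ∀ p p' q q', Bisimilar E p p' → Bisimilar E q q' →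
      Simulates E (Bisimilar E) (.cmerge p q) (.cmerge p' q') := by
    intro p p' q q' hp hq _ _ _ _ _ _ hs
    cases hs with
    | cmerge_recv_send h₁ h₂ =>
      obtain ⟨r, hr, h⟩ := hp.simulates _ _ _ _ _ _ h₁
      obtain ⟨s, hs, h'⟩ := hq.simulates _ _ _ _ _ _ h₂
      exact ⟨_, .cmerge_recv_send hr hs, h.par h'⟩
    | cmerge_send_recv h₁ h₂ =>
      obtain ⟨r, hr, h⟩ := hp.simulates _ _ _ _ _ _ h₁
      obtain ⟨s, hs, h'⟩ := hq.simulates _ _ _ _ _ _ h₂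
      exact ⟨_, .cmerge_send_recv hr hs, h.par h'⟩
  exact .intro (key _ _ _ _ hp hq) (key _ _ _ _ hp.symm hq.symm)

/-! #### The parallel operators -/

theorem Bisimilar.par_comm (p q : Policy V C X) :
    Bisimilar E (.par p q) (.par q p) := by
  refine .of_symm_rel (fun a b => ∃ p q, a = .par p q ∧ b = .par q p) ?_ ?_ ⟨p, q, rfl, rfl⟩
  · rintro _ _ ⟨p, q, rfl, rfl⟩
    exact ⟨_, _, rfl, rfl⟩
  · rintro _ _ ⟨p, q, rfl, rfl⟩ _ _ _ _ _ _ hs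
    cases hs with
    | par_l hs => exact ⟨_, .par_r hs, Or.inl ⟨_, _, rfl, rfl⟩⟩
    | par_r hs => exact ⟨_, .par_l hs, Or.inl ⟨_, _, rfl, rfl⟩⟩
    | par_send_recv h₁ h₂ => exact ⟨_, .par_recv_send h₂ h₁, Or.inl ⟨_, _, rfl, rfl⟩⟩
    | par_recv_send h₁ h₂ => exact ⟨_, .par_send_recv h₂ h₁, Or.inl ⟨_, _, rfl, rfl⟩⟩

theorem Bisimilar.par_bot (p : Policy V C X) : Bisimilar E (.par p .bot) p := by
  refine .of_symm_rel (fun a b => a = .par b .bot ∨ b = .par a .bot) ?_ ?_ (Or.inl rfl)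
  · exact fun _ _ => Or.symm
  · rintro p q (rfl | rfl) _ _ _ _ _ _ hs
    · cases hs with
      | par_l hs => exact ⟨_, hs, Or.inl (Or.inl rfl)⟩
      | par_r hs => cases hs
      | par_send_recv _ hs => cases hs
      | par_recv_send _ hs => cases hs
    · exact ⟨_, .par_l hs, Or.inl (Or.inr rfl)⟩

theorem Bisimilar.cmerge_comm (p q : Policy V C X) :
    Bisimilar E (.cmerge p q) (.cmerge q p) := by
  have key : ∀ p q, Simulates E (Bisimilar E) (.cmerge p q) (.cmerge q p) := by
    intro p q _ _ _ _ _ _ hs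
    cases hs with
    | cmerge_recv_send h₁ h₂ => exact ⟨_, .cmerge_send_recv h₂ h₁, .par_comm _ _⟩
    | cmerge_send_recv h₁ h₂ => exact ⟨_, .cmerge_recv_send h₂ h₁, .par_comm _ _⟩
  exact .intro (key p q) (key q p)

theorem Bisimilar.par_expand (p q : Policy V C X) :
    Bisimilar E (.par p q) (.choice (.choice (.lmerge p q) (.lmerge q p)) (.cmerge p q)) := by
  refine .intro ?_ ?_
  · intro _ _ _ _ _ _ hs
    cases hs with
    | par_l hs => exact ⟨_, .choice_l (.choice_l (.lmerge hs)), .refl _⟩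
    -- The summand `q ⌊⌊ p` leaves its components in the opposite order, so the successors agree
    -- only up to commutativity.
    | par_r hs => exact ⟨_, .choice_l (.choice_r (.lmerge hs)), .par_comm _ _⟩
    | par_send_recv h₁ h₂ => exact ⟨_, .choice_r (.cmerge_send_recv h₁ h₂), .refl _⟩
    | par_recv_send h₁ h₂ => exact ⟨_, .choice_r (.cmerge_recv_send h₁ h₂), .refl _⟩
  · intro _ _ _ _ _ _ hs
    cases hs with
    | choice_l hs =>
      cases hs with
      | choice_l hs => cases hs with | lmerge hs => exact ⟨_, .par_l hs, .refl _⟩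
      | choice_r hs => cases hs with | lmerge hs => exact ⟨_, .par_r hs, .par_comm _ _⟩
    | choice_r hs =>
      cases hs with
      | cmerge_recv_send h₁ h₂ => exact ⟨_, .par_recv_send h₁ h₂, .refl _⟩
      | cmerge_send_recv h₁ h₂ => exact ⟨_, .par_send_recv h₁ h₂, .refl _⟩

/-! #### The approximation induction principle -/

theorem guarded_of_forall_guarded (hE : ∀ x, Guarded E (E x)) (p : Policy V C X) :
    Guarded E p := by
  induction p with
  | bot => exact .bot
  | pre a p => exact .pre a p
  | par p q hp hq => exact .par hp hq
  | choice p q hp hq => exact .choice hp hq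
  | delta L p hp => exact .delta L hp
  | proj n p hp => exact .proj n hp
  | lmerge p q hp hq => exact .lmerge hp hq
  | cmerge p q hp hq => exact .cmerge hp hq
  | var x => exact .var (hE x)

/-- The label determines the channel and the message, so the union over all `x` and `z` has at most
one nonempty member, even with infinitely many channels. -/
theorem finite_comm_of_finite (γ : Label V C) {S T : C → Pol V → Set (Policy V C X)}
    (hS : ∀ x z, (S x z).Finite) (hT : ∀ x z, (T x z).Finite) :
    {r | ∃ x z, γ = .rcfg x z ∧ r ∈ Set.image2 par (S x z) (T x z)}.Finite := by
  cases γ with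
  | pkt | comm => simp
  | rcfg x z =>
    refine ((hS x z).image2 par (hT x z)).subset ?_
    rintro r ⟨x', z', h, hr⟩
    cases h
    exact hr

/-- Induction on guardedness rather than on the term makes unfolding a variable a legitimate
descent. Without guardedness the result fails: `X ≜ X || a;⊥` can produce infinitely many
successors. The label and lists vary in the induction because a communication of `p || q` comes from
steps with other labels. -/
theorem Guarded.finite_step {p : Policy V C X} (hp : Guarded E p) (H₀ H₁ : List (Packet V))
    (γ : Label V C) (H₀' H₁' : List (Packet V)) :
    {p' | Step E p H₀ H₁ γ p' H₀' H₁'}.Finite := by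
  induction hp generalizing H₀ H₁ γ H₀' H₁' with
  | bot =>
    refine Set.finite_empty.subset fun r hr => ?_
    cases hr
  | pre a p =>
    refine (Set.finite_singleton p).subset fun r hr => ?_
    cases hr <;> rfl
  | @par p q _ _ ihp ihq =>
    refine (((((ihp H₀ H₁ γ H₀' H₁').image (.par · q))).union
      ((ihq H₀ H₁ γ H₀' H₁').image (.par p ·))).union
      ((finite_comm_of_finite γ (fun x z => ihp H₀ H₁ (.comm (.send x z)) H₀ H₁)
        (fun x z => ihq H₀ H₁ (.comm (.recv x z)) H₀ H₁)).union
      (finite_comm_of_finite γ (fun x z => ihp H₀ H₁ (.comm (.recv x z)) H₀ H₁)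
        (fun x z => ihq H₀ H₁ (.comm (.send x z)) H₀ H₁)))).subset fun r hr => ?_
    cases hr with
    | par_l hs => exact Or.inl (Or.inl ⟨_, hs, rfl⟩)
    | par_r hs => exact Or.inl (Or.inr ⟨_, hs, rfl⟩)
    | par_send_recv h₁ h₂ => exact Or.inr (Or.inl ⟨_, _, rfl, _, h₁, _, h₂, rfl⟩)
    | par_recv_send h₁ h₂ => exact Or.inr (Or.inr ⟨_, _, rfl, _, h₁, _, h₂, rfl⟩)
  | choice _ _ ihp ihq =>
    refine ((ihp H₀ H₁ γ H₀' H₁').union (ihq H₀ H₁ γ H₀' H₁')).subset fun r hr => ?_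
    cases hr with
    | choice_l hs => exact Or.inl hs
    | choice_r hs => exact Or.inr hs
  | delta L _ ih =>
    refine ((ih H₀ H₁ γ H₀' H₁').image (.delta L)).subset fun r hr => ?_
    cases hr with
    | delta hs => exact ⟨_, hs, rfl⟩
  | proj n _ ih =>
    -- For `n = 0` the truncated index is harmless, as there are no steps.
    refine ((ih H₀ H₁ γ H₀' H₁').image (.proj (n - 1))).subset fun r hr => ?_
    cases hr with
    | proj hs => exact ⟨_, hs, rfl⟩
  | @lmerge p q _ _ ih =>
    refine ((ih H₀ H₁ γ H₀' H₁').image (.par · q)).subset fun r hr => ?_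
    cases hr with
    | lmerge hs => exact ⟨_, hs, rfl⟩
  | cmerge _ _ ihp ihq =>
    refine ((finite_comm_of_finite γ (fun x z => ihp H₀ H₁ (.comm (.send x z)) H₀ H₁)
        (fun x z => ihq H₀ H₁ (.comm (.recv x z)) H₀ H₁)).union
      (finite_comm_of_finite γ (fun x z => ihp H₀ H₁ (.comm (.recv x z)) H₀ H₁)
        (fun x z => ihq H₀ H₁ (.comm (.send x z)) H₀ H₁))).subset fun r hr => ?_
    cases hr with
    | cmerge_send_recv h₁ h₂ => exact Or.inl ⟨_, _, rfl, _, h₁, _, h₂, rfl⟩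
    | cmerge_recv_send h₁ h₂ => exact Or.inr ⟨_, _, rfl, _, h₁, _, h₂, rfl⟩
  | var _ ih =>
    refine (ih H₀ H₁ γ H₀' H₁').subset fun r hr => ?_
    cases hr with
    | var hs => exact hs

theorem Bisimilar.of_forall_proj (hE : ∀ x, Guarded E (E x)) {p q : Policy V C X}
    (h : ∀ n, Bisimilar E (.proj n p) (.proj n q)) : Bisimilar E p q := by
  refine .of_symm_rel (fun p q => ∀ n, Bisimilar E (.proj n p) (.proj n q)) ?_ ?_ h
  · exact fun p q h n => (h n).symm
  · intro p q h H₀ H₁ γ p' H₀' H₁' hs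
    have key : ∀ n, ∃ q', Step E q H₀ H₁ γ q' H₀' H₁' ∧ Bisimilar E (.proj n p') (.proj n q') := by
      intro n
      obtain ⟨r, hr, hb⟩ := (h (n + 1)).simulates _ _ _ _ _ _ (.proj hs)
      cases hr with
      | proj hr => exact ⟨_, hr, hb⟩
    by_contra! hc
    have hc' : ∀ q', ∃ n, Step E q H₀ H₁ γ q' H₀' H₁' →
        ¬ Bisimilar E (.proj n p') (.proj n q') := by
      intro q'
      by_cases hq : Step E q H₀ H₁ γ q' H₀' H₁'
      · obtain ⟨n, hn⟩ := (hc q' hq).1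
        exact ⟨n, fun _ => hn⟩
      · exact ⟨0, fun h => (hq h).elim⟩
    choose n hn using hc'
    -- Each of the finitely many successors of `q` fails at some depth; `N` bounds these depths. A
    -- successor matching at depth `N` also matches at its own failing depth.
    obtain ⟨N, hN⟩ :=
      (((guarded_of_forall_guarded hE q).finite_step H₀ H₁ γ H₀' H₁').image n).bddAbove
    obtain ⟨q', hq, hb⟩ := key N
    exact hn q' hq (hb.proj_of_le (hN ⟨q', hq, rfl⟩))

/-! ### Soundness -/

theorem Bisimilar.pre_pol_congr {z y : Pol V} (h : z.1.den = y.1.den) (p : Policy V C X) :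
    Bisimilar E (.pre (.pol z) p) (.pre (.pol y) p) := by
  refine .intro_eq fun _ _ _ _ _ _ => ⟨fun hs => ?_, fun hs => ?_⟩
  · cases hs with | pol hz => exact .pol (h ▸ hz)
  · cases hs with | pol hz => exact .pol (h ▸ hz)

theorem Bisimilar.eq_bot {p : Policy V C X}
    (h : ∀ H₀ H₁ γ p' H₀' H₁', ¬ Step E p H₀ H₁ γ p' H₀' H₁') : Bisimilar E p .bot :=
  .intro_eq fun _ _ _ _ _ _ => ⟨fun hs => (h _ _ _ _ _ _ hs).elim, nofun⟩

theorem Provable.bisimilar [∀ f, Fintype (V f)] (hE : ∀ x, Guarded E (E x))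
    {p q : Policy V C X} (h : Provable E p q) : Bisimilar E p q := by
  induction h with
  | refl p => exact .refl p
  | symm _ ih => exact ih.symm
  | trans _ _ ih₁ ih₂ => exact ih₁.trans ih₂
  | pre_congr a _ ih => exact ih.pre a
  | par_congr _ _ ih₁ ih₂ => exact ih₁.par ih₂
  | choice_congr _ _ ih₁ ih₂ => exact ih₁.choice ih₂
  | delta_congr L _ ih => exact ih.delta L
  | proj_congr n _ ih => exact ih.proj n
  | lmerge_congr _ _ ih₁ ih₂ => exact ih₁.lmerge ih₂
  | cmerge_congr _ _ ih₁ ih₂ => exact ih₁.cmerge ih₂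
  | netkat p h => exact .pre_pol_congr h.den_eq p
  | unfold x =>
    refine .intro_eq fun _ _ _ _ _ _ => ⟨fun hs => ?_, .var⟩
    cases hs with | var hs => exact hs
  | a0 p =>
    refine .eq_bot fun _ _ _ _ _ _ hs => ?_
    cases hs with | pol hz => exact hz
  | a1 z y p =>
    refine .intro_eq fun _ _ _ _ _ _ => ⟨fun hs => ?_, fun hs => ?_⟩
    · cases hs with
      | pol hz =>
        rcases hz with hz | hz
        · exact .choice_l (.pol hz)
        · exact .choice_r (.pol hz)
    · cases hs with
      | choice_l hs => cases hs with | pol hz => exact .pol (Or.inl hz)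
      | choice_r hs => cases hs with | pol hz => exact .pol (Or.inr hz)
  | a2 p q =>
    have key : ∀ p q : Policy V C X, ∀ {H₀ H₁ γ r H₀' H₁'}, Step E (.choice p q) H₀ H₁ γ r H₀' H₁' →
        Step E (.choice q p) H₀ H₁ γ r H₀' H₁' := by
      intro p q _ _ _ _ _ _ hs
      cases hs with
      | choice_l hs => exact .choice_r hs
      | choice_r hs => exact .choice_l hs
    exact .intro_eq fun _ _ _ _ _ _ => ⟨key p q, key q p⟩
  | a3 p q r =>
    refine .intro_eq fun _ _ _ _ _ _ => ⟨fun hs => ?_, fun hs => ?_⟩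
    · cases hs with
      | choice_l hs =>
        cases hs with
        | choice_l hs => exact .choice_l hs
        | choice_r hs => exact .choice_r (.choice_l hs)
      | choice_r hs => exact .choice_r (.choice_r hs)
    · cases hs with
      | choice_l hs => exact .choice_l (.choice_l hs)
      | choice_r hs =>
        cases hs with
        | choice_l hs => exact .choice_l (.choice_r hs)
        | choice_r hs => exact .choice_r hs
  | a4 p =>
    refine .intro_eq fun _ _ _ _ _ _ => ⟨fun hs => ?_, .choice_l⟩
    cases hs <;> assumption
  | a5 p =>
    refine .intro_eq fun _ _ _ _ _ _ => ⟨fun hs => ?_, .choice_l⟩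
    cases hs with
    | choice_l hs => exact hs
    | choice_r hs => cases hs
  | a6 p q => exact .par_comm p q
  | a7 p => exact .par_bot p
  | a8 p q => exact .par_expand p q
  | a9 p =>
    refine .eq_bot fun _ _ _ _ _ _ hs => ?_
    cases hs with | lmerge hs => cases hs
  | a10 a p q =>
    refine .intro_eq fun _ _ _ _ _ _ => ⟨fun hs => ?_, fun hs => ?_⟩
    · cases hs with
      | lmerge hs =>
        cases hs with
        | pol hz => exact .pol hz
        | comm => exact .comm
        | rcfg => exact .rcfg
    · cases hs with
      | pol hz => exact .lmerge (.pol hz)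
      | comm => exact .lmerge .comm
      | rcfg => exact .lmerge .rcfg
  | a11 p q r =>
    refine .intro_eq fun _ _ _ _ _ _ => ⟨fun hs => ?_, fun hs => ?_⟩
    · cases hs with
      | lmerge hs =>
        cases hs with
        | choice_l hs => exact .choice_l (.lmerge hs)
        | choice_r hs => exact .choice_r (.lmerge hs)
    · cases hs with
      | choice_l hs => cases hs with | lmerge hs => exact .lmerge (.choice_l hs)
      | choice_r hs => cases hs with | lmerge hs => exact .lmerge (.choice_r hs)
  | a12 x z p q =>
    refine .intro_eq fun _ _ _ _ _ _ => ⟨fun hs => ?_, fun hs => ?_⟩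
    · cases hs with
      | cmerge_recv_send h₁ h₂ => cases h₁; cases h₂; exact .rcfg
      | cmerge_send_recv h₁ h₂ => cases h₁
    · cases hs with | rcfg => exact .cmerge_recv_send .comm .comm
  | a13 p q r =>
    refine .intro_eq fun _ _ _ _ _ _ => ⟨fun hs => ?_, fun hs => ?_⟩
    · cases hs with
      | cmerge_recv_send h₁ h₂ =>
        cases h₁ with
        | choice_l h₁ => exact .choice_l (.cmerge_recv_send h₁ h₂)
        | choice_r h₁ => exact .choice_r (.cmerge_recv_send h₁ h₂)
      | cmerge_send_recv h₁ h₂ =>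
        cases h₁ with
        | choice_l h₁ => exact .choice_l (.cmerge_send_recv h₁ h₂)
        | choice_r h₁ => exact .choice_r (.cmerge_send_recv h₁ h₂)
    · cases hs with
      | choice_l hs =>
        cases hs with
        | cmerge_recv_send h₁ h₂ => exact .cmerge_recv_send (.choice_l h₁) h₂
        | cmerge_send_recv h₁ h₂ => exact .cmerge_send_recv (.choice_l h₁) h₂
      | choice_r hs =>
        cases hs with
        | cmerge_recv_send h₁ h₂ => exact .cmerge_recv_send (.choice_r h₁) h₂
        | cmerge_send_recv h₁ h₂ => exact .cmerge_send_recv (.choice_r h₁) h₂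
  | a14 p q => exact .cmerge_comm p q
  | a15_pol z p q | a15_rcfg x z p q =>
    refine .eq_bot fun _ _ _ _ _ _ hs => ?_
    cases hs with
    | cmerge_recv_send h₁ h₂ => cases h₁
    | cmerge_send_recv h₁ h₂ => cases h₁
  | a15_recv_recv x x' z z' p q | a15_send_send x x' z z' p q =>
    refine .eq_bot fun _ _ _ _ _ _ hs => ?_
    cases hs with
    | cmerge_recv_send h₁ h₂ => cases h₁ <;> cases h₂
    | cmerge_send_recv h₁ h₂ => cases h₁ <;> cases h₂
  | a15_recv_send x x' z z' p q hne =>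
    refine .eq_bot fun _ _ _ _ _ _ hs => ?_
    cases hs with
    | cmerge_recv_send h₁ h₂ => cases h₁; cases h₂; simp at hne
    | cmerge_send_recv h₁ h₂ => cases h₁
  | delta_bot L =>
    refine .eq_bot fun _ _ _ _ _ _ hs => ?_
    cases hs with | delta hs => cases hs
  | delta_pre L p _ hL =>
    refine .intro_eq fun _ _ _ _ _ _ => ⟨fun hs => ?_, fun hs => ?_⟩
    · cases hs with
      | delta hs =>
        cases hs with
        | pol hz => exact .pol hz
        | comm => exact .comm
        | rcfg => exact .rcfg
    · cases hs with
      -- Membership in `L` unfolds to the same proposition for a prefix and for its label, so `hL`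
      -- serves for both.
      | pol hz => exact .delta (.pol hz) hL
      | comm => exact .delta .comm hL
      | rcfg => exact .delta .rcfg hL
  | delta_pre_bot L p _ hL =>
    refine .eq_bot fun _ _ _ _ _ _ hs => ?_
    cases hs with
    | delta hs hL' =>
      cases hs with
      | pol hz => exact hL
      | comm => exact hL' hL
      | rcfg => exact hL
  | delta_choice L p q =>
    refine .intro_eq fun _ _ _ _ _ _ => ⟨fun hs => ?_, fun hs => ?_⟩
    · cases hs with
      | delta hs hL =>
        cases hs with
        | choice_l hs => exact .choice_l (.delta hs hL)
        | choice_r hs => exact .choice_r (.delta hs hL)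
    · cases hs with
      | choice_l hs => cases hs with | delta hs hL => exact .delta (.choice_l hs) hL
      | choice_r hs => cases hs with | delta hs hL => exact .delta (.choice_r hs) hL
  | proj_zero p =>
    refine .eq_bot fun _ _ _ _ _ _ hs => ?_
    cases hs
  | proj_bot n =>
    refine .eq_bot fun _ _ _ _ _ _ hs => ?_
    cases hs with | proj hs => cases hs
  | proj_pre n p _ =>
    refine .intro_eq fun _ _ _ _ _ _ => ⟨fun hs => ?_, fun hs => ?_⟩
    · cases hs with
      | proj hs =>
        cases hs with
        | pol hz => exact .pol hz
        | comm => exact .comm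
        | rcfg => exact .rcfg
    · cases hs with
      | pol hz => exact .proj (.pol hz)
      | comm => exact .proj .comm
      | rcfg => exact .proj .rcfg
  | proj_choice n p q =>
    refine .intro_eq fun _ _ _ _ _ _ => ⟨fun hs => ?_, fun hs => ?_⟩
    · cases hs with
      | proj hs =>
        cases hs with
        | choice_l hs => exact .choice_l (.proj hs)
        | choice_r hs => exact .choice_r (.proj hs)
    · cases hs with
      | choice_l hs => cases hs with | proj hs => exact .proj (.choice_l hs)
      | choice_r hs => cases hs with | proj hs => exact .proj (.choice_r hs)
  | aip _ ih => exact .of_forall_proj hE ih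

end

/-! ### Head normal forms and completeness -/

/-! ### Semantics of flows -/

namespace NetKAT

variable {k : ℕ} {V : Fin k → Type u}

theorem mem_den_prodList_cons (p : NetKAT V) (l : List (NetKAT V)) (h h' : History V) :
    h' ∈ (prodList (p :: l)).den h ↔ ∃ y ∈ p.den h, h' ∈ (prodList l).den y := by
  cases l with
  | nil => simp [prodList, den]
  | cons q l => rfl

theorem mem_den_completeTest (σ : Packet V) (h h' : History V) :
    h' ∈ (completeTest σ).den h ↔ h' = h ∧ h.1 = σ := by
  have key : ∀ l : List (Fin k), h' ∈ (prodList (l.map fun f => test f (σ f))).den h ↔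
      h' = h ∧ ∀ f ∈ l, h.1 f = σ f := by
    intro l
    induction l with
    | nil => simp [prodList, den]
    | cons f l ih =>
      rw [List.map_cons, mem_den_prodList_cons]
      constructor
      · rintro ⟨y, ⟨rfl, hf⟩, hh⟩
        obtain ⟨rfl, hl⟩ := ih.1 hh
        exact ⟨rfl, by simpa using ⟨hf, hl⟩⟩
      · rintro ⟨rfl, hf⟩
        simp only [List.mem_cons, forall_eq_or_imp] at hf
        exact ⟨h', ⟨rfl, hf.1⟩, ih.2 ⟨rfl, hf.2⟩⟩
  rw [completeTest, key]
  simp [funext_iff]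

theorem mem_den_completeAssign (τ : Packet V) (h h' : History V) :
    h' ∈ (completeAssign τ).den h ↔ h' = (τ, h.2) := by
  have key : ∀ (l : List (Fin k)) (h : History V),
      h' ∈ (prodList (l.map fun f => assign f (τ f))).den h ↔
      h' = (fun f => if f ∈ l then τ f else h.1 f, h.2) := by
    intro l
    induction l with
    | nil => intro h; simp [prodList, den]
    | cons f l ih =>
      intro h
      rw [List.map_cons, mem_den_prodList_cons]
      simp only [den, Set.mem_singleton_iff, exists_eq_left, ih]
      suffices (fun g => if g ∈ l then τ g else Function.update h.1 f (τ f) g) =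
          fun g => if g ∈ f :: l then τ g else h.1 g by rw [this]
      funext g
      by_cases hg : g = f
      · subst hg; simp
      · simp [hg]
  rw [completeAssign, key]
  simp

theorem mem_den_flow (σ τ : Packet V) (h h' : History V) :
    h' ∈ (Pol.flow σ τ).1.den h ↔ h.1 = σ ∧ h' = (τ, h.2) := by
  constructor
  · rintro ⟨y, hy, hh⟩
    obtain ⟨rfl, hσ⟩ := (mem_den_completeTest ..).1 hy
    exact ⟨hσ, (mem_den_completeAssign ..).1 hh⟩
  · rintro ⟨hσ, hh⟩
    exact ⟨h, (mem_den_completeTest ..).2 ⟨rfl, hσ⟩, (mem_den_completeAssign ..).2 hh⟩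

end NetKAT

section

variable {k : ℕ} {V : Fin k → Type u} {C : Type v} {X : Type w} {E : X → Policy V C X}

open Policy

/-- This is why heads are split into flows: a general `z` shares its transitions with other
policies, whereas `α · π` relates a single pair of packets, and the label records that pair. -/
theorem Act.IsAt.exists_step {a : Act V C} (ha : a.IsAt) :
    ∃ (H₀ H₁ : List (Packet V)) (γ : Label V C) (H₀' H₁' : List (Packet V)),
      (∀ p, Step E (pre a p) H₀ H₁ γ p H₀' H₁') ∧
      ∀ b p p', b.IsAt → Step E (pre b p) H₀ H₁ γ p' H₀' H₁' → b = a ∧ p' = p := by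
  cases a with
  | pol z =>
    obtain ⟨σ, τ, rfl⟩ := ha
    refine ⟨[σ], [], .pkt σ τ, [], [τ],
      fun p => .pol ((NetKAT.mem_den_flow ..).2 ⟨rfl, rfl⟩), ?_⟩
    intro b p p' hb hs
    cases hs with
    | pol hz =>
      obtain ⟨σ', τ', rfl⟩ := hb
      obtain ⟨rfl, h⟩ := (NetKAT.mem_den_flow ..).1 hz
      cases h
      exact ⟨rfl, rfl⟩
  | comm c =>
    refine ⟨[], [], .comm c, [], [], fun p => .comm, fun b p p' _ hs => ?_⟩
    cases hs
    exact ⟨rfl, rfl⟩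
  | rcfg x z =>
    refine ⟨[], [], .rcfg x z, [], [], fun p => .rcfg, fun b p p' _ hs => ?_⟩
    cases hs
    exact ⟨rfl, rfl⟩

/-- The sum `a₁;p₁ ⊕ (a₂;p₂ ⊕ ⋯)` over a list of summands. -/
def preSum (l : List (Act V C × Policy V C X)) : Policy V C X :=
  l.foldr (fun x p => choice (pre x.1 x.2) p) bot

theorem step_preSum_iff {l : List (Act V C × Policy V C X)} {H₀ H₁ : List (Packet V)}
    {γ : Label V C} {p' : Policy V C X} {H₀' H₁' : List (Packet V)} :
    Step E (preSum l) H₀ H₁ γ p' H₀' H₁' ↔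
      ∃ x ∈ l, Step E (pre x.1 x.2) H₀ H₁ γ p' H₀' H₁' := by
  induction l with
  | nil =>
    simp only [List.not_mem_nil, false_and, exists_false, iff_false]
    exact fun hs => nomatch hs
  | cons x l ih =>
    rw [List.exists_mem_cons_iff, ← ih]
    constructor
    · intro hs
      cases hs with
      | choice_l hs => exact Or.inl hs
      | choice_r hs => exact Or.inr hs
    · rintro (hs | hs)
      · exact .choice_l hs
      · exact .choice_r hs

variable [∀ f, Fintype (V f)]

instance : Trans (Provable E) (Provable E) (Provable E) := ⟨Provable.trans⟩

/-- `p` is provably a sum of prefixed policies, the prefixes being of the form `at`. -/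
def HasHeadNormalForm (E : X → Policy V C X) (p : Policy V C X) : Prop :=
  ∃ l : List (Act V C × Policy V C X), (∀ x ∈ l, x.1.IsAt) ∧ Provable E p (preSum l)

/-! ### Closure of head normal forms under the operators -/

namespace HasHeadNormalForm

theorem of_provable {p q : Policy V C X} (h : Provable E p q) (hq : HasHeadNormalForm E q) :
    HasHeadNormalForm E p :=
  let ⟨l, hl, hp⟩ := hq
  ⟨l, hl, h.trans hp⟩

theorem bot : HasHeadNormalForm E bot := ⟨[], by simp, .refl _⟩

theorem pre_isAt {a : Act V C} (ha : a.IsAt) (p : Policy V C X) :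
    HasHeadNormalForm E (pre a p) :=
  ⟨[(a, p)], by simpa using ha, .symm (.a5 _)⟩

theorem choice {p q : Policy V C X} (hp : HasHeadNormalForm E p) (hq : HasHeadNormalForm E q) :
    HasHeadNormalForm E (choice p q) := by
  obtain ⟨l, hl, hp⟩ := hp
  obtain ⟨l', hl', hq⟩ := hq
  refine of_provable (.choice_congr hp hq) ⟨l ++ l', ?_, ?_⟩
  · intro x hx
    exact (List.mem_append.1 hx).elim (hl x) (hl' x)
  · clear hl hp
    induction l with
    | nil => exact (Provable.a2 _ _).trans (.a5 _)
    | cons x l ih => exact (Provable.a3 _ _ _).trans (.choice_congr (.refl _) ih)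

/-- A NetKAT prefix is replaced by a sum of flows, which A1 distributes over the choice; A0 removes
the final `0`. -/
theorem pre (a : Act V C) (p : Policy V C X) : HasHeadNormalForm E (pre a p) := by
  cases a with
  | pol z =>
    obtain ⟨l, hl⟩ := Pol.exists_provable_flows z
    refine of_provable (.netkat p hl) ?_
    clear hl
    induction l with
    | nil => exact of_provable (.a0 p) bot
    | cons x l ih =>
      exact of_provable (.a1 _ _ p)
        (choice (pre_isAt (a := .pol (.flow x.1 x.2)) ⟨_, _, rfl⟩ p) ih)
  | comm c => exact pre_isAt (a := .comm c) trivial p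
  | rcfg x z => exact pre_isAt (a := .rcfg x z) trivial p

theorem delta (L : Set (Comm V C)) {p : Policy V C X} (hp : HasHeadNormalForm E p) :
    HasHeadNormalForm E (delta L p) := by
  obtain ⟨l, hl, hp⟩ := hp
  refine of_provable (.delta_congr L hp) ?_
  clear hp
  induction l with
  | nil => exact of_provable (.delta_bot L) bot
  | cons x l ih =>
    rw [List.forall_mem_cons] at hl
    refine of_provable (.delta_choice L _ _) (choice ?_ (ih hl.2))
    by_cases hL : x.1.InSet L
    · exact of_provable (.delta_pre_bot L _ hl.1 hL) bot
    · exact of_provable (.delta_pre L _ hl.1 hL) (pre _ _)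

theorem proj (n : ℕ) {p : Policy V C X} (hp : HasHeadNormalForm E p) :
    HasHeadNormalForm E (proj n p) := by
  obtain ⟨l, hl, hp⟩ := hp
  refine of_provable (.proj_congr n hp) ?_
  clear hp
  cases n with
  | zero => exact of_provable (.proj_zero _) bot
  | succ n =>
    induction l with
    | nil => exact of_provable (.proj_bot _) bot
    | cons x l ih =>
      rw [List.forall_mem_cons] at hl
      exact of_provable (.proj_choice _ _ _)
        (choice (of_provable (.proj_pre n _ hl.1) (pre _ _)) (ih hl.2))

theorem lmerge {p : Policy V C X} (hp : HasHeadNormalForm E p) (q : Policy V C X) :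
    HasHeadNormalForm E (lmerge p q) := by
  obtain ⟨l, hl, hp⟩ := hp
  refine of_provable (.lmerge_congr hp (.refl q)) ?_
  clear hl hp
  induction l with
  | nil => exact of_provable (.a9 _) bot
  | cons x l ih =>
    exact of_provable (.a11 _ _ _) (choice (of_provable (.a10 _ _ _) (pre _ _)) ih)

/-- No axiom treats `⊥ | q` directly, but `⊥` is provably `0;⊥`, to which A15 for NetKAT prefixes
applies. -/
theorem cmerge_bot (q : Policy V C X) : HasHeadNormalForm E (.cmerge .bot q) :=
  of_provable (.trans (.cmerge_congr (.symm (.a0 .bot)) (.refl q)) (.a15_pol _ _ _)) bot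

theorem cmerge_pre_pre (a b : Act V C) (p q : Policy V C X) :
    HasHeadNormalForm E (.cmerge (.pre a p) (.pre b q)) := by
  have key : ∀ (x x' : C) (z z' : Pol V) (p q : Policy V C X), HasHeadNormalForm E
      (.cmerge (.pre (.comm (.recv x z)) p) (.pre (.comm (.send x' z')) q)) := by
    intro x x' z z' p q
    by_cases h : x = x' ∧ z = z'
    · obtain ⟨rfl, rfl⟩ := h
      exact of_provable (.a12 x z p q) (pre _ _)
    · exact of_provable (.a15_recv_send x x' z z' p q (not_and_or.1 h)) bot
  match a, b with
  | .pol z, _ => exact of_provable (.a15_pol _ _ _) bot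
  | .rcfg x z, _ => exact of_provable (.a15_rcfg _ _ _ _) bot
  | _, .pol z => exact of_provable ((Provable.a14 _ _).trans (.a15_pol _ _ _)) bot
  | _, .rcfg x z => exact of_provable ((Provable.a14 _ _).trans (.a15_rcfg _ _ _ _)) bot
  | .comm (.recv x z), .comm (.recv x' z') =>
    exact of_provable (.a15_recv_recv _ _ _ _ _ _) bot
  | .comm (.send x z), .comm (.send x' z') =>
    exact of_provable (.a15_send_send _ _ _ _ _ _) bot
  | .comm (.recv x z), .comm (.send x' z') => exact key ..
  | .comm (.send x z), .comm (.recv x' z') => exact of_provable (.a14 _ _) (key ..)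

theorem cmerge {p q : Policy V C X} (hp : HasHeadNormalForm E p) (hq : HasHeadNormalForm E q) :
    HasHeadNormalForm E (cmerge p q) := by
  obtain ⟨l, -, hp⟩ := hp
  obtain ⟨l', -, hq⟩ := hq
  refine of_provable (.cmerge_congr hp hq) ?_
  clear hp hq
  induction l with
  | nil => exact cmerge_bot _
  | cons x l ih =>
    refine of_provable (.a13 _ _ _) (choice ?_ ih)
    -- A13 distributes on the left only, so the arguments are swapped before the second sum is
    -- expanded.
    refine of_provable (.a14 _ _) ?_
    clear ih
    induction l' with
    | nil => exact cmerge_bot _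
    | cons y l' ih' => exact of_provable (.a13 _ _ _) (choice (cmerge_pre_pre ..) ih')

theorem par {p q : Policy V C X} (hp : HasHeadNormalForm E p) (hq : HasHeadNormalForm E q) :
    HasHeadNormalForm E (par p q) :=
  of_provable (.a8 p q) (((hp.lmerge q).choice (hq.lmerge p)).choice (hp.cmerge hq))

end HasHeadNormalForm

/-- Nothing below a prefix is touched, so recursion through variables stops where guardedness does.
-/
theorem Guarded.hasHeadNormalForm {p : Policy V C X} (hp : Guarded E p) :
    HasHeadNormalForm E p := by
  induction hp with
  | bot => exact .bot
  | pre a p => exact .pre a p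
  | par _ _ hp hq => exact hp.par hq
  | choice _ _ hp hq => exact hp.choice hq
  | delta L _ hp => exact hp.delta L
  | proj n _ hp => exact hp.proj n
  | lmerge _ _ hp _ => exact hp.lmerge _
  | cmerge _ _ hp hq => exact hp.cmerge hq
  | var _ hp => exact .of_provable (.unfold _) hp

/-! ### Absorption of summands and completeness -/

theorem provable_choice_preSum_of_mem {l : List (Act V C × Policy V C X)}
    {x : Act V C × Policy V C X} (hx : x ∈ l) :
    Provable E (choice (pre x.1 x.2) (preSum l)) (preSum l) := by
  induction l with
  | nil => simp at hx
  | cons y l ih =>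
    rcases List.mem_cons.1 hx with rfl | hx
    · exact (Provable.a3 _ _ _).symm.trans (.choice_congr (.a4 _) (.refl _))
    · calc Provable E (choice (pre x.1 x.2) (choice (pre y.1 y.2) (preSum l))) _ :=
            (Provable.a3 _ _ _).symm
        Provable E _ (choice (choice (pre y.1 y.2) (pre x.1 x.2)) (preSum l)) :=
          .choice_congr (.a2 _ _) (.refl _)
        Provable E _ _ := .a3 _ _ _
        Provable E _ _ := .choice_congr (.refl _) (ih hx)

theorem provable_proj_succ_preSum (n : ℕ) {l : List (Act V C × Policy V C X)}
    (hl : ∀ x ∈ l, x.1.IsAt) :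
    Provable E (proj (n + 1) (preSum l)) (preSum (l.map fun x => (x.1, proj n x.2))) := by
  induction l with
  | nil => exact .proj_bot _
  | cons x l ih =>
    rw [List.forall_mem_cons] at hl
    exact (Provable.proj_choice _ _ _).trans (.choice_congr (.proj_pre n _ hl.1) (ih hl.2))

theorem provable_choice_preSum {l l' : List (Act V C × Policy V C X)}
    (h : ∀ x ∈ l, ∃ y ∈ l', x.1 = y.1 ∧ Provable E x.2 y.2) :
    Provable E (choice (preSum l) (preSum l')) (preSum l') := by
  induction l with
  | nil => exact (Provable.a2 _ _).trans (.a5 _)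
  | cons x l ih =>
    rw [List.forall_mem_cons] at h
    obtain ⟨⟨y, hy, hxy, hp⟩, h⟩ := h
    refine (Provable.a3 _ _ _).trans ((Provable.choice_congr (.refl _) (ih h)).trans ?_)
    rw [hxy]
    exact (Provable.choice_congr (.pre_congr _ hp) (.refl _)).trans
      (provable_choice_preSum_of_mem hy)

theorem Bisimilar.provable_proj (hE : ∀ x, Guarded E (E x)) (n : ℕ) {p q : Policy V C X}
    (h : Bisimilar E p q) : Provable E (.proj n p) (.proj n q) := by
  induction n generalizing p q with
  | zero => exact (Provable.proj_zero p).trans (Provable.proj_zero q).symm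
  | succ n ih =>
    obtain ⟨l, hl, hp⟩ := (guarded_of_forall_guarded hE p).hasHeadNormalForm
    obtain ⟨l', hl', hq⟩ := (guarded_of_forall_guarded hE q).hasHeadNormalForm
    -- Soundness transfers the bisimilarity of `p` and `q` to their head normal forms.
    have hb : Bisimilar E (preSum l) (preSum l') :=
      ((hp.bisimilar hE).symm.trans h).trans (hq.bisimilar hE)
    have key : ∀ l l' : List (Act V C × Policy V C X), (∀ x ∈ l, x.1.IsAt) →
        (∀ x ∈ l', x.1.IsAt) → Bisimilar E (preSum l) (preSum l') →
        Provable E (.choice (preSum (l.map fun x => (x.1, .proj n x.2)))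
          (preSum (l'.map fun x => (x.1, .proj n x.2))))
          (preSum (l'.map fun x => (x.1, .proj n x.2))) := by
      intro l l' hl hl' hb
      refine provable_choice_preSum (List.forall_mem_map.2 fun x hx => ?_)
      -- The transition characteristic of the prefix `x.1` must be answered by a summand of `l'`
      -- with that same prefix, and the continuations are bisimilar.
      obtain ⟨H₀, H₁, γ, H₀', H₁', hs, hs'⟩ := (hl x hx).exists_step (E := E)
      obtain ⟨r, hr, hxr⟩ := hb.simulates _ _ _ _ _ _ (step_preSum_iff.2 ⟨x, hx, hs x.2⟩)
      obtain ⟨y, hy, hr⟩ := step_preSum_iff.1 hr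
      obtain ⟨hyx, rfl⟩ := hs' _ _ _ (hl' y hy) hr
      exact ⟨_, List.mem_map.2 ⟨y, hy, rfl⟩, hyx.symm, ih hxr⟩
    -- Each sum absorbs the other, so both equal their choice, by antisymmetry of the order that `⊕`
    -- defines.
    calc Provable E (.proj (n + 1) p) _ := .proj_congr _ hp
      Provable E _ _ := provable_proj_succ_preSum n hl
      Provable E _ _ := (key l' l hl' hl hb.symm).symm
      Provable E _ _ := .a2 _ _
      Provable E _ _ := key l l' hl hl' hb
      Provable E _ _ := (provable_proj_succ_preSum n hl').symm
      Provable E _ _ := (Provable.proj_congr _ hq).symm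

theorem Bisimilar.provable (hE : ∀ x, Guarded E (E x)) {p q : Policy V C X}
    (h : Bisimilar E p q) : Provable E p q :=
  .aip fun n => h.provable_proj hE n

end

end DyNetKAT

theorem mainTheorem1 {k : ℕ} {V : Fin k → Type*} [∀ f, Fintype (V f)] {C X : Type*}
    (E : X → DyNetKAT.Policy V C X) (hE : ∀ x, DyNetKAT.Guarded E (E x)) :
    (∀ p q : DyNetKAT.Policy V C X, DyNetKAT.Provable E p q → DyNetKAT.Bisimilar E p q) ∧
    (∀ p q : DyNetKAT.Policy V C X, DyNetKAT.Bisimilar E p q → DyNetKAT.Provable E p q) := by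
  exact ⟨fun _ _ h => h.bisimilar hE, fun _ _ h => h.provable hE⟩
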